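/- Let $V=V_b\cup V_r$ be a finite set of $n=n_b+n_r$ nodes with $V_b=\{1,\dots,n_b\}$ and $V_r$ a set of $n_r\ge 1$ reference nodes. Each node $u$ has a node variable $x_u\in\mathbb R$, known only if $u\in V_r$. The undirected measurement graph $\mathcal G(k)$, $k=0,1,\dots$, on $V$ takes values in $\{\mathcal G_1,\dots,\mathcal G_N\}$ and evolves as an $N$-state homogeneous Markov chain that is ergodic (irreducible and aperiodic), with transition probabilities $p_{ij}$ satisfying $p_{ii}>0$ for all $i$. For every edge $(u,v)$ of $\mathcal G(k)$ a measurement $\zeta_{u,v}(k)=x_u-x_v+\epsilon_{u,v}(k)$ is available, where $\epsilon_{v,u}(k)=-\epsilon_{u,v}(k)$ and the noise vector $(\epsilon_{u,v}(k))_{u,v\in V}$ is a jointly wide-sense stationary process, independent of the Markov chain. With $\mathcal N_u(k)$ the set of neighbors of $u$ in $\mathcal G(k)$, the estimates are updated by $$\hat x_u(k+1)=\frac{w_{uu}(k)\hat x_u(k)+\sum_{v\in\mathcal N_u(k)}w_{vu}(k)\,(\hat x_v(k)+\zeta_{u,v}(k))}{w_{uu}(k)+\sum_{v\in\mathcal N_u(k)}w_{vu}(k)}\quad(u\in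 V_b),\qquad \hat x_u(k)=x_u\quad(u\in V_r),$$ where the weights are positive and may vary with time and with the state of the chain, but from some time $k_0$ on depend only on the state of the chain. Let $\mathbf e(k)=(\hat x_u(k)-x_u)_{u\in V_b}$. We say that $\mathbf e(k)$ is mean square convergent if $\mathrm E[\mathbf e(k)]$ and $\mathrm E[\mathbf e(k)\mathbf e(k)^T]$ converge as $k\to\infty$ for every initial condition, to limits that do not depend on the initial condition; here an initial condition is any square-integrable random vector $(\hat x_u(0))_{u\in V_b}$ that is, together with the noise, independent of the Markov chain. Let $\hat{\mathcal G}=\bigcup_{i=1}^N\mathcal G_i$ be the union graph. Then $\mathbf e(k)$ is mean square convergent if and only if in $\hat{\mathcal G}$ every node of $V_b$ is connected by a path to a reference node. In particular, $\mathbf e(k)$ is mean square convergent whenever $\hat{\mathcal G}$ is connected, and if there is a single reference node ($n_r=1$), then $\mathbf e(k)$ is mean square convergent if and only if $\hat{\mathcal G}$ is connected. -/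

import Mathlib

open MeasureTheory ProbabilityTheory Filter Topology

noncomputable section

namespace RelMeas

/-! ### Finite Markov chains -/

/-- `θ` is a homogeneous Markov chain with transition matrix `P` (where `P i j` is the probability
of a jump from `i` to `j`) and arbitrary initial distribution. -/
structure IsMarkovChain {Ω : Type*} [MeasurableSpace Ω] {N : ℕ} (P : Matrix (Fin N) (Fin N) ℝ)
    (θ : ℕ → Ω → Fin N) (μ : Measure Ω) : Prop where
  measurable : ∀ k, Measurable (θ k)
  stochastic : P ∈ Matrix.rowStochastic ℝ (Fin N)
  markov : ∀ (n : ℕ) (s : ℕ → Fin N),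
    μ.real {ω | ∀ k ≤ n + 1, θ k ω = s k} =
      μ.real {ω | ∀ k ≤ n, θ k ω = s k} * P (s n) (s (n + 1))

/-- Every state has period one. -/
def IsAperiodic {N : ℕ} (P : Matrix (Fin N) (Fin N) ℝ) : Prop :=
  ∀ (i : Fin N) (d : ℕ), (∀ n : ℕ, 0 < n → 0 < (P ^ n) i i → d ∣ n) → d = 1

/-- A finite chain is ergodic if it is irreducible and aperiodic. -/
def IsErgodic {N : ℕ} (P : Matrix (Fin N) (Fin N) ℝ) : Prop :=
  P.IsIrreducible ∧ IsAperiodic P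

/-! ### Second-order processes -/

/-- A (jointly) wide sense stationary real vector process: square integrable, with constant mean
and with correlations that are invariant under time shifts. -/
structure IsWideSenseStationary {Ω ι : Type*} [MeasurableSpace Ω]
    (ε : ℕ → ι → Ω → ℝ) (μ : Measure Ω) : Prop where
  measurable : ∀ k a, Measurable (ε k a)
  memLp : ∀ k a, MemLp (ε k a) 2 μ
  mean : ∀ k l a, ∫ ω, ε k a ω ∂μ = ∫ ω, ε l a ω ∂μ
  correlation : ∀ k l h a b,
    ∫ ω, ε (k + h) a ω * ε (l + h) b ω ∂μ = ∫ ω, ε k a ω * ε l b ω ∂μ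

/-- The vector process `y` has finite second moments, its mean `E[y(k)]` converges to `m` and its
correlation matrix `E[y(k) y(k)ᵀ]` converges to `Q`. -/
structure HasMeanSquareLimit {Ω ι : Type*} [MeasurableSpace Ω]
    (y : ℕ → ι → Ω → ℝ) (m : ι → ℝ) (Q : Matrix ι ι ℝ) (μ : Measure Ω) : Prop where
  memLp : ∀ k a, MemLp (y k a) 2 μ
  mean : ∀ a, Tendsto (fun k => ∫ ω, y k a ω ∂μ) atTop (𝓝 (m a))
  correlation : ∀ a b, Tendsto (fun k => ∫ ω, y k a ω * y k b ω ∂μ) atTop (𝓝 (Q a b))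

/-! ### The distributed algorithm -/

/-- The nodes: `nb` nodes that do not know their node variable, and `nr` reference nodes. -/
abbrev Node (nb nr : ℕ) : Type := Fin nb ⊕ Fin nr

open Classical in
/-- One iteration of the algorithm in the measurement graph `G`, with weights `w v u` (the weight
that `u` gives to the information received from `v`) and relative measurements `ζ u v`. -/
def update {nb nr : ℕ} (G : SimpleGraph (Node nb nr)) (w : Node nb nr → Node nb nr → ℝ)
    (ζ : Node nb nr → Node nb nr → ℝ) (x xhat : Node nb nr → ℝ) : Node nb nr → ℝ
  | .inl u =>
      (w (.inl u) (.inl u) * xhat (.inl u) +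
          ∑ v ∈ G.neighborFinset (.inl u), w v (.inl u) * (xhat v + ζ (.inl u) v)) /
        (w (.inl u) (.inl u) + ∑ v ∈ G.neighborFinset (.inl u), w v (.inl u))
  | .inr r => x (.inr r)

/-- The estimates along one realization: `x` are the true node variables, `x0` the initial
estimates, `s k` the state of the chain at time `k`, `G i` the measurement graph and `w k i` the
weights that are used at time `k` if the chain is in state `i`, and `ε k (u, v)` the noise in the
measurement `x u - x v + ε k (u, v)`. -/
def estimate {N nb nr : ℕ} (G : Fin N → SimpleGraph (Node nb nr))
    (w : ℕ → Fin N → Node nb nr → Node nb nr → ℝ) (x : Node nb nr → ℝ) (x0 : Fin nb → ℝ)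
    (s : ℕ → Fin N) (ε : ℕ → Node nb nr × Node nb nr → ℝ) : ℕ → Node nb nr → ℝ
  | 0 => Sum.elim x0 (fun r => x (.inr r))
  | k + 1 => update (G (s k)) (w k (s k)) (fun u v => x u - x v + ε k (u, v)) x
      (estimate G w x x0 s ε k)

/-- The estimation error vector `e(k)` (of the nodes that are not reference nodes), as a stochastic
process. -/
def estimationError {Ω : Type*} {N nb nr : ℕ} (G : Fin N → SimpleGraph (Node nb nr))
    (w : ℕ → Fin N → Node nb nr → Node nb nr → ℝ) (x : Node nb nr → ℝ) (x0 : Fin nb → Ω → ℝ)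
    (θ : ℕ → Ω → Fin N) (ε : ℕ → Node nb nr × Node nb nr → Ω → ℝ) (k : ℕ) (u : Fin nb) (ω : Ω) :
    ℝ :=
  estimate G w x (fun v => x0 v ω) (fun j => θ j ω) (fun j a => ε j a ω) k (.inl u) - x (.inl u)

/-- An admissible random initial condition: a square integrable random vector `x0` such that `x0`
and the noise are together independent of the Markov chain (constants are a special case). -/
structure IsInitialCondition {Ω ι κ : Type*} [MeasurableSpace Ω] {N : ℕ}
    (x0 : κ → Ω → ℝ) (θ : ℕ → Ω → Fin N) (ε : ℕ → ι → Ω → ℝ) (μ : Measure Ω) : Prop where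
  measurable : ∀ u, Measurable (x0 u)
  memLp : ∀ u, MemLp (x0 u) 2 μ
  indep : IndepFun (fun ω => ((fun u => x0 u ω), (fun k a => ε k a ω))) (fun ω k => θ k ω) μ

/-- The estimation error is mean square convergent: its mean and its correlation converge for
every initial condition, to limits that do not depend on the initial condition. -/
def IsMeanSquareConvergent {Ω : Type*} [MeasurableSpace Ω] {N nb nr : ℕ}
    (G : Fin N → SimpleGraph (Node nb nr))
    (w : ℕ → Fin N → Node nb nr → Node nb nr → ℝ) (x : Node nb nr → ℝ)
    (θ : ℕ → Ω → Fin N) (ε : ℕ → Node nb nr × Node nb nr → Ω → ℝ) (μ : Measure Ω) : Prop :=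
  ∃ (m : Fin nb → ℝ) (Q : Matrix (Fin nb) (Fin nb) ℝ), ∀ x0 : Fin nb → Ω → ℝ,
    IsInitialCondition x0 θ ε μ → HasMeanSquareLimit (estimationError G w x x0 θ ε) m Q μ

/-- The union graph. -/
def unionGraph {N : ℕ} {V : Type*} (G : Fin N → SimpleGraph V) : SimpleGraph V := ⨆ i, G i

end RelMeas

end

/-!
The estimation error satisfies `e(k+1) = A(θ(k)) e(k) + B(θ(k)) ε(k)`, where the substochastic
matrix `A(i)` averages over the neighbors in `G i`; a row of `A(i)` has sum less than one exactly
at the neighbors of reference nodes, whose errors are zero (`update_sub`). By superposition, `e(k)`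
is the sum of the response to the initial condition and of the responses to the noise of all ages
`p < k` (`eq_response`). The coefficients of these responses are products of the matrices along the
chain, and they are independent of the initial condition and of the noise. So the moments of `e(k)`
are sums of moments of coefficients times moments of the noise, and the latter depend only on ages.

If every node is connected to a reference node in the union graph, these sums converge by
Tannery's theorem, for two reasons.

* Each term converges: for fixed ages, the coefficients are determined by finitely many consecutive
  states, whose joint law converges since the chain is ergodic
  (`IsMarkovChain.exists_tendsto_integral_shift`).
* The terms are dominated: the mean of a coefficient decays exponentially in the age
  (`IsMarkovChain.exists_integral_le`). The expectations `E[(Φ(n) 1)_u ; θ(n) = j]` for the products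
  `Φ(n)` satisfy a positive linear recursion, and the iterates of the stationary law under this
  recursion decrease. Strict decrease at one pair `(j, u)` spreads along the transitions of the
  chain, as the matrices have positive diagonal, and along the edges of the union graph, so that
  after finitely many steps there is strict decrease at all pairs (`exists_survival_lt`). Since
  coefficients lie in `[0, 1]`, the mean of a product of two is at most the geometric mean of their
  means, and hence also decays exponentially.

Conversely, if a component of the union graph contains no reference node, then shifting the initial
estimates on it by a constant shifts the estimates at all later times by the same constant, so
that the mean errors cannot have a common limit for all initial conditions (`estimate_add_one`).
-/

namespace RelMeas

open scoped Matrix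

/-! ### Geometric decay and convergence of the distribution of a finite Markov chain -/

/-- An antitone sequence that shrinks by the factor `ρ` over every `T` steps decays
geometrically. -/
theorem exists_geometric_bound {d : ℕ → ℝ} (hd : Antitone d) (h0 : ∀ n, 0 ≤ d n) {T : ℕ}
    (hT : 0 < T) {ρ : ℝ} (hρ0 : 0 < ρ) (hρ1 : ρ < 1) (h : ∀ n, d (n + T) ≤ ρ * d n) :
    ∃ C r : ℝ, 0 ≤ C ∧ 0 < r ∧ r < 1 ∧ ∀ n, d n ≤ C * r ^ n := by
  have hr0 : 0 < ρ ^ (1 / (T : ℝ)) := Real.rpow_pos_of_pos hρ0 _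
  have hr1 : ρ ^ (1 / (T : ℝ)) < 1 := Real.rpow_lt_one hρ0.le hρ1 (by positivity)
  have hrT : (ρ ^ (1 / (T : ℝ))) ^ T = ρ := by
    rw [one_div]; exact Real.rpow_inv_natCast_pow hρ0.le hT.ne'
  set r := ρ ^ (1 / (T : ℝ))
  have key : ∀ m, d (T * m) ≤ ρ ^ m * d 0 := by
    intro m
    induction m with
    | zero => simp
    | succ m ih =>
      calc d (T * (m + 1)) ≤ ρ * d (T * m) := h (T * m)
        _ ≤ ρ * (ρ ^ m * d 0) := by gcongr
        _ = ρ ^ (m + 1) * d 0 := by ring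
  refine ⟨d 0 / ρ, r, div_nonneg (h0 0) hρ0.le, hr0, hr1, fun n => ?_⟩
  have h1 : d n ≤ ρ ^ (n / T) * d 0 := (hd (Nat.mul_div_le n T)).trans (key _)
  have h2 : ρ ^ (n / T) * ρ ≤ r ^ n := by
    calc ρ ^ (n / T) * ρ = r ^ (T * (n / T) + T) := by rw [pow_add, pow_mul, hrT]
      _ ≤ r ^ n := by
        apply pow_le_pow_of_le_one hr0.le hr1.le
        have := Nat.div_add_mod n T
        have := Nat.mod_lt n hT
        omega
  calc d n ≤ ρ ^ (n / T) * d 0 := h1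
    _ = (ρ ^ (n / T) * ρ) * (d 0 / ρ) := by field_simp
    _ ≤ r ^ n * (d 0 / ρ) := by
      have := h0 0
      gcongr
    _ = d 0 / ρ * r ^ n := by ring

section Stochastic

variable {n : Type*} [Fintype n] [DecidableEq n] {P : Matrix n n ℝ}

/-- An irreducible matrix with positive diagonal is primitive: once an entry of a power is
positive, it stays positive for all higher powers. -/
theorem isPrimitive_of_isIrreducible_of_diag_pos (hP : P.IsIrreducible) (hd : ∀ i, 0 < P i i) :
    P.IsPrimitive := by
  have hmono : ∀ i j k, 0 < (P ^ k) i j → 0 < (P ^ (k + 1)) i j := by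
    intro i j k h
    rw [pow_succ, Matrix.mul_apply]
    exact Finset.sum_pos' (fun l _ => mul_nonneg (Matrix.pow_apply_nonneg hP.nonneg k i l)
      (hP.nonneg l j)) ⟨j, Finset.mem_univ _, mul_pos h (hd j)⟩
  have hmono' : ∀ i j k l, k ≤ l → 0 < (P ^ k) i j → 0 < (P ^ l) i j := by
    intro i j k l hkl h
    induction l, hkl using Nat.le_induction with
    | base => exact h
    | succ l _ ih => exact hmono _ _ _ ih
  have h := (Matrix.isIrreducible_iff_exists_pow_pos hP.nonneg).1 hP
  choose k hk hpos using h
  refine ⟨hP.nonneg, ∑ i, ∑ j, k i j + 1, Nat.succ_pos _, fun i j => ?_⟩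
  refine hmono' i j (k i j) _ ?_ (hpos i j)
  calc k i j ≤ ∑ j, k i j := Finset.single_le_sum (fun _ _ => Nat.zero_le _) (Finset.mem_univ j)
    _ ≤ ∑ i, ∑ j, k i j :=
      Finset.single_le_sum (f := fun i => ∑ j, k i j) (fun _ _ => Nat.zero_le _)
        (Finset.mem_univ i)
    _ ≤ _ := Nat.le_succ _

theorem sum_vecMul_of_mem_rowStochastic (hP : P ∈ Matrix.rowStochastic ℝ n) (d : n → ℝ) :
    ∑ j, (d ᵥ* P) j = ∑ i, d i := by
  simp only [Matrix.vecMul, dotProduct]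
  rw [Finset.sum_comm]
  simp [← Finset.mul_sum, Matrix.sum_row_of_mem_rowStochastic hP]

/-- Doeblin's contraction: a stochastic matrix with all entries at least `δ` contracts the `ℓ¹`
norm of vectors of total mass zero. -/
theorem sum_abs_vecMul_le (hP : P ∈ Matrix.rowStochastic ℝ n) {δ : ℝ} (hδ : ∀ i j, δ ≤ P i j)
    {d : n → ℝ} (hd : ∑ i, d i = 0) :
    ∑ j, |(d ᵥ* P) j| ≤ (1 - Fintype.card n * δ) * ∑ i, |d i| := by
  have h1 : ∀ j, (d ᵥ* P) j = ∑ i, d i * (P i j - δ) := by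
    intro j
    simp only [Matrix.vecMul, dotProduct, mul_sub, Finset.sum_sub_distrib, ← Finset.sum_mul, hd]
    ring
  calc ∑ j, |(d ᵥ* P) j| ≤ ∑ j, ∑ i, |d i| * (P i j - δ) := by
        refine Finset.sum_le_sum fun j _ => ?_
        rw [h1]
        refine (Finset.abs_sum_le_sum_abs _ _).trans (Finset.sum_le_sum fun i _ => ?_)
        rw [abs_mul, abs_of_nonneg (sub_nonneg.2 (hδ i j))]
    _ = (1 - Fintype.card n * δ) * ∑ i, |d i| := by
        rw [Finset.sum_comm, Finset.mul_sum]
        refine Finset.sum_congr rfl fun i _ => ?_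
        rw [← Finset.mul_sum, Finset.sum_sub_distrib, Matrix.sum_row_of_mem_rowStochastic hP]
        simp [mul_comm]

/-- The distribution of a finite Markov chain with primitive transition matrix converges. -/
theorem exists_tendsto_of_isPrimitive (hP : P ∈ Matrix.rowStochastic ℝ n) (hprim : P.IsPrimitive)
    {v : ℕ → n → ℝ} (hv : ∀ k, v (k + 1) = v k ᵥ* P) : ∃ ϖ, Tendsto v atTop (𝓝 ϖ) := by
  rcases isEmpty_or_nonempty n with hn | hn
  · exact ⟨v 0, tendsto_const_nhds.congr fun k => Subsingleton.elim _ _⟩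
  obtain ⟨m, hm, hpos⟩ := hprim.exists_pos_pow
  obtain ⟨p, hp⟩ := Finite.exists_min (fun p : n × n => (P ^ m) p.1 p.2)
  set δ := (P ^ m) p.1 p.2
  have hδ : 0 < δ := hpos _ _
  have hPm : P ^ m ∈ Matrix.rowStochastic ℝ n := Submonoid.pow_mem _ hP m
  have hcard : (0 : ℝ) < Fintype.card n := by exact_mod_cast Fintype.card_pos
  have hcδ : Fintype.card n * δ ≤ 1 := by
    obtain ⟨i⟩ := hn
    rw [← Matrix.sum_row_of_mem_rowStochastic hPm i]
    have := Finset.sum_le_sum (s := Finset.univ) fun j _ => hp (i, j)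
    simpa using this
  have hsum : ∀ k, ∑ i, (v (k + 1) - v k) i = 0 := by
    intro k
    simp [hv, sum_vecMul_of_mem_rowStochastic hP]
  have hstep : ∀ k, v (k + 1 + 1) - v (k + 1) = (v (k + 1) - v k) ᵥ* P := by
    intro k
    rw [Matrix.sub_vecMul, ← hv, ← hv]
  have hsteps : ∀ l k, v (k + l + 1) - v (k + l) = (v (k + 1) - v k) ᵥ* P ^ l := by
    intro l k
    induction l with
    | zero => simp
    | succ l ih => rw [← add_assoc, hstep, ih, pow_succ, Matrix.vecMul_vecMul]
  set d : ℕ → ℝ := fun k => ∑ i, |(v (k + 1) - v k) i|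
  have hd0 : ∀ k, 0 ≤ d k := fun k => Finset.sum_nonneg fun _ _ => abs_nonneg _
  have hanti : Antitone d := by
    refine antitone_nat_of_succ_le fun k => ?_
    have := sum_abs_vecMul_le hP (δ := 0)
      (fun i j => Matrix.nonneg_of_mem_rowStochastic hP) (hsum k)
    rw [← hstep] at this
    simpa [d] using this
  -- the contraction factor is halved towards one to make sure that it is positive
  obtain ⟨C, r, -, -, hr1, hb⟩ := exists_geometric_bound hanti hd0 hm
    (ρ := 1 - Fintype.card n * δ / 2) (by nlinarith) (by nlinarith [mul_pos hcard hδ]) (by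
      intro k
      have := sum_abs_vecMul_le hPm (fun i j => hp (i, j)) (hsum k)
      rw [← hsteps] at this
      refine this.trans ?_
      have : 0 ≤ Fintype.card n * δ * d k := by have := hd0 k; positivity
      change (1 - Fintype.card n * δ) * d k ≤ _
      nlinarith)
  have hcauchy : CauchySeq v := by
    refine cauchySeq_of_le_geometric r C hr1 fun k => ?_
    refine le_trans ?_ (hb k)
    rw [dist_comm, dist_pi_le_iff (hd0 k)]
    intro i
    rw [Real.dist_eq]
    exact Finset.single_le_sum (f := fun i => |(v (k + 1) - v k) i|)
      (fun _ _ => abs_nonneg _) (Finset.mem_univ i)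
  exact cauchySeq_tendsto_of_complete hcauchy

/-- The limit distribution of a finite Markov chain with primitive transition matrix is invariant
and charges every state. -/
theorem exists_pos_invariant (hP : P ∈ Matrix.rowStochastic ℝ n) (hprim : P.IsPrimitive)
    {v : ℕ → n → ℝ} (hv : ∀ k, v (k + 1) = v k ᵥ* P) (hv0 : ∀ k i, 0 ≤ v k i)
    (hv1 : ∑ i, v 0 i = 1) :
    ∃ ϖ : n → ℝ, Tendsto v atTop (𝓝 ϖ) ∧ (∀ i, 0 < ϖ i) ∧ ϖ ᵥ* P = ϖ := by
  obtain ⟨ϖ, hϖ⟩ := exists_tendsto_of_isPrimitive hP hprim hv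
  have hinv : ϖ ᵥ* P = ϖ := by
    refine tendsto_nhds_unique ?_ ((tendsto_add_atTop_iff_nat 1).2 hϖ)
    have hc : Continuous fun x : n → ℝ => x ᵥ* P := by fun_prop
    simpa only [hv, Function.comp_def] using (hc.tendsto ϖ).comp hϖ
  have hnonneg : ∀ i, 0 ≤ ϖ i := fun i =>
    ge_of_tendsto' ((continuous_apply i).tendsto ϖ |>.comp hϖ) fun k => hv0 k i
  have hsumv : ∀ k, ∑ i, v k i = 1 := by
    intro k
    induction k with
    | zero => exact hv1
    | succ k ih => rw [hv, sum_vecMul_of_mem_rowStochastic hP, ih]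
  have hsum : ∑ i, ϖ i = 1 := by
    refine tendsto_nhds_unique (tendsto_finsetSum _ fun i _ =>
      ((continuous_apply i).tendsto ϖ).comp hϖ) ?_
    simp [hsumv]
  obtain ⟨m, -, hpos⟩ := hprim.exists_pos_pow
  have hpow : ∀ k, ϖ ᵥ* P ^ k = ϖ := by
    intro k
    induction k with
    | zero => simp
    | succ k ih => rw [pow_succ, ← Matrix.vecMul_vecMul, ih, hinv]
  refine ⟨ϖ, hϖ, fun j => ?_, hinv⟩
  obtain ⟨i, hi⟩ : ∃ i, 0 < ϖ i := by
    by_contra! h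
    have : ∑ i, ϖ i ≤ 0 := Finset.sum_nonpos fun i _ => h i
    linarith
  rw [← hpow m]
  exact Finset.sum_pos' (fun l _ => mul_nonneg (hnonneg l) (hpos l j).le)
    ⟨i, Finset.mem_univ _, mul_pos hi (hpos i j)⟩

end Stochastic

/-! ### Functionals of finitely many steps of the chain -/

section

theorem measurable_of_dependsOn {S : Type*} [Finite S] [MeasurableSpace S]
    [MeasurableSingletonClass S] {F : (ℕ → S) → ℝ} {t : Set ℕ} (ht : t.Finite)
    (hF : DependsOn F t) : Measurable F := by
  obtain ⟨g, rfl⟩ := dependsOn_iff_exists_comp.1 hF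
  have := ht.to_subtype
  exact (measurable_of_countable g).comp (measurable_pi_lambda _ fun i => measurable_pi_apply _)

theorem exists_abs_le_of_dependsOn {S : Type*} [Finite S] {F : (ℕ → S) → ℝ} {t : Set ℕ}
    (ht : t.Finite) (hF : DependsOn F t) : ∃ C, ∀ s, |F s| ≤ C := by
  obtain ⟨g, rfl⟩ := dependsOn_iff_exists_comp.1 hF
  have := ht.to_subtype
  obtain ⟨C, hC⟩ := (Set.finite_range fun a => |g a|).bddAbove
  exact ⟨C, fun s => hC ⟨_, rfl⟩⟩

variable {Ω : Type*} [MeasurableSpace Ω] {μ : Measure Ω} {N : ℕ}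
  {P : Matrix (Fin N) (Fin N) ℝ} {θ : ℕ → Ω → Fin N}

/-- The law of the state at time `k`. -/
noncomputable def stateLaw (θ : ℕ → Ω → Fin N) (μ : Measure Ω) (k : ℕ)
    (i : Fin N) : ℝ :=
  ∫ ω, (if θ k ω = i then 1 else 0) ∂μ

theorem stateLaw_nonneg (k : ℕ) (i : Fin N) : 0 ≤ stateLaw θ μ k i :=
  integral_nonneg fun ω => by dsimp only; split_ifs <;> simp

namespace IsMarkovChain

theorem measurable_path (hθ : IsMarkovChain P θ μ) : Measurable fun ω k => θ k ω :=
  measurable_pi_lambda _ hθ.measurable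

theorem memLp_comp (hθ : IsMarkovChain P θ μ) {F : (ℕ → Fin N) → ℝ} {t : Set ℕ} (ht : t.Finite)
    (hF : DependsOn F t) : MemLp (fun ω => F fun k => θ k ω) ⊤ μ := by
  obtain ⟨C, hC⟩ := exists_abs_le_of_dependsOn ht hF
  exact memLp_top_of_bound
    ((measurable_of_dependsOn ht hF).comp hθ.measurable_path).aestronglyMeasurable C
    (ae_of_all _ fun ω => hC _)

variable [IsProbabilityMeasure μ]

theorem integrable_comp (hθ : IsMarkovChain P θ μ) {F : (ℕ → Fin N) → ℝ} {t : Set ℕ}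
    (ht : t.Finite) (hF : DependsOn F t) : Integrable (fun ω => F fun k => θ k ω) μ :=
  (hθ.memLp_comp ht hF).integrable le_top

/-- The Markov property, for functionals of the history up to time `n`. -/
theorem integral_mul_ite (hθ : IsMarkovChain P θ μ) {n : ℕ} {F : (ℕ → Fin N) → ℝ}
    (hF : DependsOn F (Set.Iic n)) (j : Fin N) :
    ∫ ω, F (fun k => θ k ω) * (if θ (n + 1) ω = j then 1 else 0) ∂μ =
      ∫ ω, F (fun k => θ k ω) * P (θ n ω) j ∂μ := by
  classical
  -- the histories up to time `n`, extended to all times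
  set t : (Fin (n + 1) → Fin N) → ℕ → Fin N := fun a k => a ⟨min k n, by omega⟩
  set H : (Fin (n + 1) → Fin N) → Set Ω := fun a => {ω | ∀ k ≤ n, θ k ω = t a k}
  have hH : ∀ a, MeasurableSet (H a) := fun a =>
    measurableSet_setOfPred.2 (Measurable.forall fun k => Measurable.forall fun _ =>
      measurableSet_setOfPred.1 (hθ.measurable k (measurableSet_singleton _)))
  have hexp : ∀ g : Ω → ℝ, (fun ω => F (fun k => θ k ω) * g ω) =
      fun ω => ∑ a, F (t a) * (H a).indicator g ω := by
    intro g
    ext ω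
    rw [Finset.sum_eq_single (fun k : Fin (n + 1) => θ k ω)]
    · have h1 : ω ∈ H (fun k : Fin (n + 1) => θ k ω) := fun k hk => by simp [t, hk]
      rw [Set.indicator_of_mem h1]
      congr 1
      exact hF fun k hk => h1 k hk
    · intro a _ ha
      rw [Set.indicator_of_notMem, mul_zero]
      intro hω
      refine ha (funext fun k => ?_)
      rw [hω k (by omega)]
      simp only [t]
      congr 1
      ext
      simp only
      omega
    · simp
  have hind : ∀ g : Ω → ℝ, Integrable g μ →
      ∫ ω, F (fun k => θ k ω) * g ω ∂μ = ∑ a, F (t a) * ∫ ω in H a, g ω ∂μ := by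
    intro g hg
    rw [hexp, integral_finsetSum _ fun a _ => (hg.indicator (hH a)).const_mul _]
    simp only [integral_const_mul, integral_indicator (hH _)]
  have hj : MeasurableSet {ω | θ (n + 1) ω = j} := hθ.measurable _ (measurableSet_singleton j)
  have hg1 : (fun ω => if θ (n + 1) ω = j then (1 : ℝ) else 0) =
      {ω | θ (n + 1) ω = j}.indicator 1 := by
    ext ω; simp [Set.indicator_apply]
  have hint1 : Integrable (fun ω => if θ (n + 1) ω = j then (1 : ℝ) else 0) μ := by
    rw [hg1]; exact (integrable_const (1 : ℝ)).indicator hj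
  have hint2 : Integrable (fun ω => P (θ n ω) j) μ :=
    hθ.integrable_comp (F := fun s => P (s n) j) (Set.finite_singleton n)
      fun x y h => by simp [h n rfl]
  rw [hind _ hint1, hind _ hint2]
  refine Finset.sum_congr rfl fun a _ => ?_
  congr 1
  have hright : ∫ ω in H a, P (θ n ω) j ∂μ = ∫ ω in H a, P (t a n) j ∂μ :=
    setIntegral_congr_fun (hH a) fun ω hω => by simp only [hω n le_rfl]
  rw [hright, setIntegral_const, hg1, setIntegral_indicator hj, smul_eq_mul]
  have hm := hθ.markov n (Function.update (t a) (n + 1) j)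
  have e1 : {ω | ∀ k ≤ n + 1, θ k ω = Function.update (t a) (n + 1) j k} =
      H a ∩ {ω | θ (n + 1) ω = j} := by
    ext ω
    constructor
    · intro h
      refine ⟨fun k hk => ?_, by simpa using h (n + 1) le_rfl⟩
      simpa [Function.update_of_ne (show k ≠ n + 1 by omega)] using h k (by omega)
    · rintro ⟨h1, h2⟩ k hk
      rcases hk.eq_or_lt with rfl | hk
      · simpa using h2
      · simpa [Function.update_of_ne (show k ≠ n + 1 by omega)] using h1 k (by omega)
  have e2 : {ω | ∀ k ≤ n, θ k ω = Function.update (t a) (n + 1) j k} = H a := by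
    ext ω
    refine forall₂_congr fun k hk => ?_
    rw [Function.update_of_ne (by omega)]
  rw [e1, e2] at hm
  simpa using hm

theorem integrable_mul_ite (hθ : IsMarkovChain P θ μ) {F : (ℕ → Fin N) → ℝ} {t : Set ℕ}
    (ht : t.Finite) (hF : DependsOn F t) (k : ℕ) (j : Fin N) :
    Integrable (fun ω => F (fun k => θ k ω) * (if θ k ω = j then 1 else 0)) μ := by
  refine hθ.integrable_comp (F := fun s => F s * (if s k = j then 1 else 0))
    (ht.union (Set.finite_singleton k)) fun x y h => ?_
  dsimp only
  rw [hF fun i hi => h i (Or.inl hi), h k (Or.inr rfl)]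

theorem integral_eq_sum_ite (hθ : IsMarkovChain P θ μ) {F : (ℕ → Fin N) → ℝ} {t : Set ℕ}
    (ht : t.Finite) (hF : DependsOn F t) (k : ℕ) :
    ∫ ω, F (fun k => θ k ω) ∂μ =
      ∑ j, ∫ ω, F (fun k => θ k ω) * (if θ k ω = j then 1 else 0) ∂μ := by
  rw [← integral_finsetSum _ fun j _ => hθ.integrable_mul_ite ht hF k j]
  simp

/-- Conditioning on the present state in the Markov property. -/
theorem integral_mul_ite_succ (hθ : IsMarkovChain P θ μ) {n : ℕ} {F : (ℕ → Fin N) → ℝ}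
    (hF : DependsOn F (Set.Iic n)) (j : Fin N) :
    ∫ ω, F (fun k => θ k ω) * (if θ (n + 1) ω = j then 1 else 0) ∂μ =
      ∑ i, P i j * ∫ ω, F (fun k => θ k ω) * (if θ n ω = i then 1 else 0) ∂μ := by
  rw [hθ.integral_mul_ite hF, hθ.integral_eq_sum_ite (F := fun s => F s * P (s n) j)
    (Set.finite_Iic n) (fun x y h => by dsimp only; rw [hF h, h n (Set.mem_Iic.2 le_rfl)]) n]
  refine Finset.sum_congr rfl fun i _ => ?_
  rw [← integral_const_mul]
  congr 1 with ω
  dsimp only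
  split_ifs with h
  · rw [h]; ring
  · ring

theorem stateLaw_succ (hθ : IsMarkovChain P θ μ) (k : ℕ) :
    stateLaw θ μ (k + 1) = stateLaw θ μ k ᵥ* P := by
  ext j
  have := hθ.integral_mul_ite_succ (n := k) (F := fun _ => 1) (fun _ _ _ => rfl) j
  simp only [one_mul] at this
  simp only [stateLaw, this, Matrix.vecMul, dotProduct, mul_comm]

theorem sum_stateLaw (hθ : IsMarkovChain P θ μ) (k : ℕ) : ∑ i, stateLaw θ μ k i = 1 := by
  have := hθ.integral_eq_sum_ite (F := fun _ => 1) Set.finite_empty (fun _ _ _ => rfl) k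
  simpa [stateLaw] using this.symm

theorem exists_stateLaw_limit (hθ : IsMarkovChain P θ μ) (hP : IsErgodic P)
    (hd : ∀ i, 0 < P i i) :
    ∃ ϖ : Fin N → ℝ, Tendsto (stateLaw θ μ) atTop (𝓝 ϖ) ∧ (∀ i, 0 < ϖ i) ∧ ϖ ᵥ* P = ϖ :=
  exists_pos_invariant hθ.stochastic (isPrimitive_of_isIrreducible_of_diag_pos hP.1 hd)
    hθ.stateLaw_succ stateLaw_nonneg (hθ.sum_stateLaw 0)

/-- The joint law of finitely many consecutive states converges, as the window moves to
infinity. -/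
theorem exists_tendsto_integral_shift (hθ : IsMarkovChain P θ μ) (hP : IsErgodic P)
    (hd : ∀ i, 0 < P i i) (n : ℕ) {F : (ℕ → Fin N) → ℝ} (hF : DependsOn F (Set.Iic n)) :
    ∃ L, Tendsto (fun k => ∫ ω, F (fun l => θ (k + l) ω) ∂μ) atTop (𝓝 L) := by
  -- the functional of the shifted path, as a functional of the path
  have hshift : ∀ (m : ℕ) (F : (ℕ → Fin N) → ℝ), DependsOn F (Set.Iic m) → ∀ k,
      DependsOn (fun s : ℕ → Fin N => F fun l => s (k + l)) (Set.Iic (k + m)) :=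
    fun m F hF k x y h => hF fun i hi => h (k + i) (by simp at hi ⊢; exact hi)
  induction n generalizing F with
  | zero =>
    obtain ⟨ϖ, hϖ, -⟩ := hθ.exists_stateLaw_limit hP hd
    refine ⟨∑ i, F (fun _ => i) * ϖ i, ?_⟩
    have h : ∀ k, ∫ ω, F (fun l => θ (k + l) ω) ∂μ = ∑ i, F (fun _ => i) * stateLaw θ μ k i := by
      intro k
      rw [hθ.integral_eq_sum_ite (Set.finite_Iic _) (hshift 0 F hF k) k]
      refine Finset.sum_congr rfl fun i _ => ?_
      rw [stateLaw, ← integral_const_mul]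
      congr 1 with ω
      split_ifs with h
      · congr 1
        exact hF fun l hl => by simp at hl; simp [hl, h]
      · simp
    simp only [h]
    exact tendsto_finsetSum _ fun i _ =>
      (((continuous_apply i).tendsto ϖ).comp hϖ).const_mul _
  | succ n ih =>
    -- fix the last state to reduce to a shorter window
    set Fj : Fin N → (ℕ → Fin N) → ℝ := fun j s => F (Function.update s (n + 1) j)
    have hFj : ∀ j, DependsOn (Fj j) (Set.Iic n) := by
      intro j x y h
      refine hF fun i hi => ?_
      rcases eq_or_ne i (n + 1) with rfl | hne
      · simp
      · rw [Function.update_of_ne hne, Function.update_of_ne hne]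
        exact h i (by simp at hi ⊢; omega)
    have hFjP : ∀ j, DependsOn (fun s => Fj j s * P (s n) j) (Set.Iic n) := fun j x y h => by
      dsimp only
      rw [hFj j h, h n (Set.mem_Iic.2 le_rfl)]
    choose L hL using fun j => ih (hFjP j)
    refine ⟨∑ j, L j, (tendsto_finsetSum _ fun j _ => hL j).congr fun k => ?_⟩
    rw [hθ.integral_eq_sum_ite (Set.finite_Iic _) (hshift _ F hF k) (k + n + 1)]
    refine Finset.sum_congr rfl fun j _ => ?_
    have := hθ.integral_mul_ite (hshift n _ (hFj j) k) j
    refine this.symm.trans ?_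
    congr 1 with ω
    split_ifs with h
    · rw [mul_one, mul_one]
      refine congrArg F (funext fun l => ?_)
      rcases eq_or_ne l (n + 1) with rfl | hne
      · rw [Function.update_self, ← h]; rfl
      · rw [Function.update_of_ne hne]
    · simp

end IsMarkovChain

end

/-! ### Exponential decay of random products of leaky substochastic matrices -/

section

/-- A family of lazy substochastic matrices such that, from every index, a row with sum less than
one can be reached through positive entries of members of the family (so that mass is eventually
lost from every index). Reachability is expressed by quantifying over sets that contain the leaking
indices and are closed under predecessors. -/
structure IsLeaky {ι V : Type*} [Fintype V] (A : ι → Matrix V V ℝ) : Prop where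
  nonneg : ∀ i u v, 0 ≤ A i u v
  sum_le_one : ∀ i u, ∑ v, A i u v ≤ 1
  diag_pos : ∀ i u, 0 < A i u u
  mem_of_closed : ∀ T : Set V, (∀ i u, ∑ v, A i u v < 1 → u ∈ T) →
    (∀ i u v, 0 < A i u v → v ∈ T → u ∈ T) → ∀ u, u ∈ T

section Survival

variable {N : ℕ} {V : Type*} [Fintype V]

/-- The linear recursion satisfied by `E[(Φ(n) 1)_u ; θ(n) = j]`, where `Φ(n)` is the product of
the matrices `A` along the first `n` steps of a chain with transition matrix `P`, started from
`ϖ`. -/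
def survival (P : Matrix (Fin N) (Fin N) ℝ) (A : Fin N → Matrix V V ℝ) (ϖ : Fin N → ℝ) :
    ℕ → Fin N → V → ℝ
  | 0 => fun j _ => ϖ j
  | n + 1 => fun j u => ∑ i, P i j * ∑ v, A i u v * survival P A ϖ n i v

variable {P : Matrix (Fin N) (Fin N) ℝ} {A : Fin N → Matrix V V ℝ} {ϖ : Fin N → ℝ}

theorem survival_nonneg (hP : ∀ i j, 0 ≤ P i j) (hA : ∀ i u v, 0 ≤ A i u v) (hϖ : ∀ i, 0 ≤ ϖ i)
    (n : ℕ) (j : Fin N) (u : V) : 0 ≤ survival P A ϖ n j u := by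
  induction n generalizing j u with
  | zero => exact hϖ j
  | succ n ih =>
    exact Finset.sum_nonneg fun i _ => mul_nonneg (hP i j)
      (Finset.sum_nonneg fun v _ => mul_nonneg (hA i u v) (ih i v))

theorem survival_antitone (hP : ∀ i j, 0 ≤ P i j) (hA : IsLeaky A) (hϖ : ∀ i, 0 < ϖ i)
    (hinv : ϖ ᵥ* P = ϖ) : Antitone fun n => survival P A ϖ n := by
  refine antitone_nat_of_succ_le fun n => ?_
  induction n with
  | zero =>
    intro j u
    calc survival P A ϖ 1 j u = ∑ i, P i j * ((∑ v, A i u v) * ϖ i) := by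
          simp only [survival, Finset.sum_mul]
      _ ≤ ∑ i, P i j * (1 * ϖ i) := by
          gcongr with i
          · exact hP i j
          · exact (hϖ i).le
          · exact hA.sum_le_one i u
      _ = ϖ j := by
          conv_rhs => rw [← hinv]
          simp [Matrix.vecMul, dotProduct, mul_comm]
  | succ n ih =>
    intro j u
    change ∑ i, P i j * ∑ v, A i u v * survival P A ϖ (n + 1) i v ≤
      ∑ i, P i j * ∑ v, A i u v * survival P A ϖ n i v
    gcongr with i _ v
    · exact hP i j
    · exact hA.nonneg i u v
    · exact ih i v

/-- If some mass has been lost in one of the states from which `j` can be entered, then some mass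
is lost in `j` at the next step. -/
theorem survival_succ_lt (hP : ∀ i j, 0 ≤ P i j) (hA : IsLeaky A) (hϖ : ∀ i, 0 < ϖ i)
    (hinv : ϖ ᵥ* P = ϖ) {n : ℕ} {i j : Fin N} {u : V} (hij : 0 < P i j)
    (h : ∑ v, A i u v * survival P A ϖ n i v < ϖ i) : survival P A ϖ (n + 1) j u < ϖ j := by
  have hle : ∀ i, ∑ v, A i u v * survival P A ϖ n i v ≤ ϖ i := by
    intro i
    calc ∑ v, A i u v * survival P A ϖ n i v ≤ ∑ v, A i u v * ϖ i := by
          gcongr with v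
          · exact hA.nonneg i u v
          · exact survival_antitone hP hA hϖ hinv (Nat.zero_le n) i v
      _ ≤ 1 * ϖ i := by
          rw [← Finset.sum_mul]
          exact mul_le_mul_of_nonneg_right (hA.sum_le_one i u) (hϖ i).le
      _ = ϖ i := one_mul _
  calc survival P A ϖ (n + 1) j u = ∑ i, P i j * ∑ v, A i u v * survival P A ϖ n i v := rfl
    _ < ∑ i, P i j * ϖ i :=
        Finset.sum_lt_sum (fun i _ => mul_le_mul_of_nonneg_left (hle i) (hP i j))
          ⟨i, Finset.mem_univ _, mul_lt_mul_of_pos_left h hij⟩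
    _ = ϖ j := by
        conv_rhs => rw [← hinv]
        simp [Matrix.vecMul, dotProduct, mul_comm]

theorem survival_mul_lt (hP : ∀ i j, 0 ≤ P i j) (hA : IsLeaky A) (hϖ : ∀ i, 0 < ϖ i)
    (hinv : ϖ ᵥ* P = ϖ) {n : ℕ} {i : Fin N} {u v : V} (huv : 0 < A i u v)
    (h : survival P A ϖ n i v < ϖ i) : ∑ v, A i u v * survival P A ϖ n i v < ϖ i := by
  calc ∑ v, A i u v * survival P A ϖ n i v < ∑ v, A i u v * ϖ i :=
        Finset.sum_lt_sum (fun v _ => mul_le_mul_of_nonneg_left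
          (survival_antitone hP hA hϖ hinv (Nat.zero_le n) i v) (hA.nonneg i u v))
          ⟨v, Finset.mem_univ _, mul_lt_mul_of_pos_left h huv⟩
    _ ≤ 1 * ϖ i := by
        rw [← Finset.sum_mul]
        exact mul_le_mul_of_nonneg_right (hA.sum_le_one i u) (hϖ i).le
    _ = ϖ i := one_mul _

/-- Mass is eventually lost at every pair of a state and an index: by irreducibility of the chain
and laziness of the matrices, loss at `(i, u)` spreads to all `(j, u)`, and then to all
predecessors of `u`. -/
theorem exists_survival_lt (hPs : P ∈ Matrix.rowStochastic ℝ (Fin N)) (hPi : P.IsIrreducible)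
    (hA : IsLeaky A) (hϖ : ∀ i, 0 < ϖ i) (hinv : ϖ ᵥ* P = ϖ) (j : Fin N) (u : V) :
    ∃ n, survival P A ϖ n j u < ϖ j := by
  have hP := hPi.nonneg
  have hsucc : ∀ i, ∃ j, 0 < P i j := by
    intro i
    by_contra! h
    have h1 := Matrix.sum_row_of_mem_rowStochastic hPs i
    have h2 : ∑ j, P i j ≤ 0 := Finset.sum_nonpos fun j _ => h j
    linarith
  have hspread : ∀ u i n, survival P A ϖ n i u < ϖ i →
      ∀ j, ∃ n, survival P A ϖ n j u < ϖ j := by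
    intro u i n h j
    obtain ⟨m, -, hm⟩ := (Matrix.isIrreducible_iff_exists_pow_pos hP).1 hPi i j
    induction m generalizing j with
    | zero =>
      rcases eq_or_ne i j with rfl | hne
      · exact ⟨n, h⟩
      · simp [hne] at hm
    | succ m ih =>
      rw [pow_succ, Matrix.mul_apply] at hm
      obtain ⟨l, -, hl⟩ := Finset.exists_lt_of_sum_lt (f := fun _ => (0 : ℝ)) (by simpa using hm)
      have hl1 : 0 < (P ^ m) i l :=
        (Matrix.pow_apply_nonneg hP m i l).lt_of_ne fun h => by simp [← h] at hl
      have hl2 : 0 < P l j := (hP l j).lt_of_ne fun h => by simp [← h] at hl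
      obtain ⟨n', hn'⟩ := ih l hl1
      exact ⟨n' + 1, survival_succ_lt hP hA hϖ hinv hl2
        (survival_mul_lt hP hA hϖ hinv (hA.diag_pos l u) hn')⟩
  suffices h : u ∈ {u | ∃ i n, survival P A ϖ n i u < ϖ i} by
    obtain ⟨i, n, h⟩ := h
    exact hspread u i n h j
  refine hA.mem_of_closed _ (fun i u h => ?_) (fun i u v huv => ?_) u
  · obtain ⟨j, hj⟩ := hsucc i
    refine ⟨j, 1, survival_succ_lt hP hA hϖ hinv hj ?_⟩
    simp only [survival, ← Finset.sum_mul]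
    exact mul_lt_of_lt_one_left (hϖ i) h
  · rintro ⟨i', n', h⟩
    obtain ⟨n, hn⟩ := hspread v i' n' h i
    obtain ⟨j, hj⟩ := hsucc i
    exact ⟨j, n + 1, survival_succ_lt hP hA hϖ hinv hj (survival_mul_lt hP hA hϖ hinv huv hn)⟩

theorem exists_survival_le (hPs : P ∈ Matrix.rowStochastic ℝ (Fin N)) (hPi : P.IsIrreducible)
    (hA : IsLeaky A) (hϖ : ∀ i, 0 < ϖ i) (hinv : ϖ ᵥ* P = ϖ) :
    ∃ C r : ℝ, 0 ≤ C ∧ 0 < r ∧ r < 1 ∧ ∀ n u, ∑ j, survival P A ϖ n j u ≤ C * r ^ n := by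
  have hP := hPi.nonneg
  have hanti := survival_antitone hP hA hϖ hinv
  have h0 := survival_nonneg hP hA.nonneg fun i => (hϖ i).le
  choose t ht using exists_survival_lt hPs hPi hA hϖ hinv
  set T := ∑ j, ∑ u, t j u + 1
  have hT : ∀ j u, survival P A ϖ T j u < ϖ j := by
    intro j u
    refine lt_of_le_of_lt (hanti (?_ : t j u ≤ T) j u) (ht j u)
    calc t j u ≤ ∑ u, t j u :=
          Finset.single_le_sum (fun _ _ => Nat.zero_le _) (Finset.mem_univ u)
      _ ≤ ∑ j, ∑ u, t j u :=
          Finset.single_le_sum (f := fun j => ∑ u, t j u) (fun _ _ => Nat.zero_le _)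
            (Finset.mem_univ j)
      _ ≤ _ := Nat.le_succ _
  obtain ⟨ρ, hρ0, hρ1, hρ⟩ :
      ∃ ρ : ℝ, 0 < ρ ∧ ρ < 1 ∧ ∀ j u, survival P A ϖ T j u ≤ ρ * ϖ j := by
    rcases isEmpty_or_nonempty (Fin N × V) with hE | hE
    · exact ⟨1 / 2, by norm_num, by norm_num, fun j u => (hE.false (j, u)).elim⟩
    · obtain ⟨p, hp⟩ := Finite.exists_max fun p : Fin N × V => survival P A ϖ T p.1 p.2 / ϖ p.1
      refine ⟨max (survival P A ϖ T p.1 p.2 / ϖ p.1) (1 / 2), by positivity,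
        max_lt ((div_lt_one (hϖ _)).2 (hT _ _)) (by norm_num), fun j u => ?_⟩
      rw [← div_le_iff₀ (hϖ j)]
      exact (hp (j, u)).trans (le_max_left _ _)
  have hstep : ∀ n j u, survival P A ϖ (n + T) j u ≤ ρ * survival P A ϖ n j u := by
    intro n
    induction n with
    | zero =>
      rw [Nat.zero_add]
      exact hρ
    | succ n ih =>
      intro j u
      rw [Nat.add_right_comm]
      simp only [survival, Finset.mul_sum]
      refine Finset.sum_le_sum fun i _ => Finset.sum_le_sum fun v _ => ?_
      calc P i j * (A i u v * survival P A ϖ (n + T) i v)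
          ≤ P i j * (A i u v * (ρ * survival P A ϖ n i v)) :=
            mul_le_mul_of_nonneg_left (mul_le_mul_of_nonneg_left (ih i v) (hA.nonneg i u v))
              (hP i j)
        _ = ρ * (P i j * (A i u v * survival P A ϖ n i v)) := by ring
  obtain ⟨C, r, hC, hr0, hr1, hb⟩ := exists_geometric_bound
    (d := fun n => ∑ u, ∑ j, survival P A ϖ n j u)
    (fun n m hnm => Finset.sum_le_sum fun u _ => Finset.sum_le_sum fun j _ => hanti hnm j u)
    (fun n => Finset.sum_nonneg fun u _ => Finset.sum_nonneg fun j _ => h0 n j u)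
    (T := T) (Nat.succ_pos _) hρ0 hρ1 (fun n => by
      simp only [Finset.mul_sum]
      exact Finset.sum_le_sum fun u _ => Finset.sum_le_sum fun j _ => hstep n j u)
  refine ⟨C, r, hC, hr0, hr1, fun n u => le_trans ?_ (hb n)⟩
  exact Finset.single_le_sum (f := fun u => ∑ j, survival P A ϖ n j u)
    (fun u _ => Finset.sum_nonneg fun j _ => h0 n j u) (Finset.mem_univ u)

end Survival

variable {Ω : Type*} [MeasurableSpace Ω] {μ : Measure Ω} [IsProbabilityMeasure μ] {N : ℕ}
  {P : Matrix (Fin N) (Fin N) ℝ} {θ : ℕ → Ω → Fin N} {V : Type*} [Fintype V]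
  {A : Fin N → Matrix V V ℝ}

theorem dependsOn_mulVec_iterate {k₁ : ℕ} {R : ℕ → (ℕ → Fin N) → V → ℝ}
    (hR0 : ∀ u, DependsOn (fun s => R 0 s u) (Set.Iio k₁))
    (hR : ∀ n s u, R (n + 1) s u = ∑ v, A (s (k₁ + n)) u v * R n s v) (n : ℕ) (u : V) :
    DependsOn (fun s => R n s u) (Set.Iio (k₁ + n)) := by
  induction n generalizing u with
  | zero => exact hR0 u
  | succ n ih =>
    intro x y h
    simp only [hR]
    refine Finset.sum_congr rfl fun v _ => ?_
    have h1 : R n x v = R n y v := ih v fun i hi => h i (by simp at hi ⊢; omega)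
    rw [h1, h (k₁ + n) (by simp)]

/-- Vectors that are driven by the matrices `A` along the chain from some time `k₁` on decay
exponentially in mean, uniformly in `k₁` and in the vector at time `k₁`. -/
theorem IsMarkovChain.exists_integral_le (hθ : IsMarkovChain P θ μ) (hP : IsErgodic P)
    (hd : ∀ i, 0 < P i i) (hA : IsLeaky A) :
    ∃ C r : ℝ, 0 ≤ C ∧ 0 < r ∧ r < 1 ∧ ∀ (k₁ : ℕ) (R : ℕ → (ℕ → Fin N) → V → ℝ),
      (∀ u, DependsOn (fun s => R 0 s u) (Set.Iio k₁)) →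
      (∀ s u, R 0 s u ≤ 1) →
      (∀ n s u, R (n + 1) s u = ∑ v, A (s (k₁ + n)) u v * R n s v) →
      ∀ n u, ∫ ω, R n (fun k => θ k ω) u ∂μ ≤ C * r ^ n := by
  obtain ⟨ϖ, -, hϖ, hinv⟩ := hθ.exists_stateLaw_limit hP hd
  obtain ⟨C, r, hC, hr0, hr1, hb⟩ := exists_survival_le hθ.stochastic hP.1 hA hϖ hinv
  set M := ∑ i, (ϖ i)⁻¹
  have hM : ∀ j, 1 ≤ M * ϖ j := by
    intro j
    rw [← div_le_iff₀ (hϖ j), one_div]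
    exact Finset.single_le_sum (f := fun i => (ϖ i)⁻¹) (fun i _ => (inv_pos.2 (hϖ i)).le)
      (Finset.mem_univ j)
  have hM0 : 0 ≤ M := Finset.sum_nonneg fun i _ => (inv_pos.2 (hϖ i)).le
  refine ⟨M * C, r, mul_nonneg hM0 hC, hr0, hr1, fun k₁ R hdep hle hR n u => ?_⟩
  have hdepn := dependsOn_mulVec_iterate hdep hR
  have key : ∀ n j u, ∫ ω, R n (fun k => θ k ω) u * (if θ (k₁ + n) ω = j then 1 else 0) ∂μ ≤
      M * survival P A ϖ n j u := by
    intro n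
    induction n with
    | zero =>
      intro j u
      calc _ ≤ ∫ _, (1 : ℝ) ∂μ := by
            refine integral_mono (hθ.integrable_mul_ite (Set.finite_Iio _) (hdepn 0 u) _ j)
              (integrable_const _) fun ω => ?_
            dsimp only
            split_ifs
            · simpa using hle _ u
            · simp
        _ ≤ M * ϖ j := by simpa using hM j
    | succ n ih =>
      intro j u
      have hdep' : DependsOn (fun s => R (n + 1) s u) (Set.Iic (k₁ + n)) :=
        (hdepn (n + 1) u).mono fun i hi => by simp at hi ⊢; omega
      rw [← add_assoc, hθ.integral_mul_ite_succ hdep' j]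
      simp only [survival, Finset.mul_sum]
      refine Finset.sum_le_sum fun i _ => ?_
      have h1 : ∫ ω, R (n + 1) (fun k => θ k ω) u * (if θ (k₁ + n) ω = i then 1 else 0) ∂μ =
          ∑ v, A i u v * ∫ ω, R n (fun k => θ k ω) v *
            (if θ (k₁ + n) ω = i then 1 else 0) ∂μ := by
        simp only [← integral_const_mul]
        rw [← integral_finsetSum _ fun v _ =>
          (hθ.integrable_mul_ite (Set.finite_Iio _) (hdepn n v) _ i).const_mul _]
        congr 1 with ω
        simp only [hR]
        split_ifs with h
        · simp [h]
        · simp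
      rw [h1, Finset.mul_sum]
      refine Finset.sum_le_sum fun v _ => ?_
      calc P i j * (A i u v * ∫ ω, R n (fun k => θ k ω) v *
            (if θ (k₁ + n) ω = i then 1 else 0) ∂μ)
          ≤ P i j * (A i u v * (M * survival P A ϖ n i v)) :=
            mul_le_mul_of_nonneg_left (mul_le_mul_of_nonneg_left (ih i v) (hA.nonneg i u v))
              (hP.1.nonneg i j)
        _ = M * (P i j * (A i u v * survival P A ϖ n i v)) := by ring
  rw [hθ.integral_eq_sum_ite (Set.finite_Iio _) (hdepn n u) (k₁ + n)]
  calc _ ≤ ∑ j, M * survival P A ϖ n j u := Finset.sum_le_sum fun j _ => key n j u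
    _ = M * ∑ j, survival P A ϖ n j u := (Finset.mul_sum _ _ _).symm
    _ ≤ M * (C * r ^ n) := mul_le_mul_of_nonneg_left (hb n u) hM0
    _ = M * C * r ^ n := by ring

end

/-! ### Linear recursions driven by a Markov chain -/

section Response

variable {S V K : Type*} [Fintype V]

/-- The response at time `k` to the initial condition, along the path `s`. -/
def initResponse [DecidableEq V] (A : ℕ → S → Matrix V V ℝ) : ℕ → (ℕ → S) → Matrix V V ℝ
  | 0, _ => 1
  | k + 1, s => A k (s k) * initResponse A k s

/-- The response at time `k`, along the path `s`, to the input that entered `p + 1` steps ago. The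
age `p` of the input is used as an index, because for fixed `p` the response only depends on
the last `p + 1` steps of the path. It is zero if the input would precede time zero. -/
def inputResponse (A : ℕ → S → Matrix V V ℝ) (B : ℕ → S → Matrix V K ℝ) :
    ℕ → ℕ → (ℕ → S) → Matrix V K ℝ
  | 0, _, _ => 0
  | k + 1, 0, s => B k (s k)
  | k + 1, p + 1, s => A k (s k) * inputResponse A B k p s

variable {A : ℕ → S → Matrix V V ℝ} {B : ℕ → S → Matrix V K ℝ}

theorem mulVec_mem_unitInterval {M : Matrix V V ℝ} (h0 : ∀ u v, 0 ≤ M u v)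
    (h1 : ∀ u, ∑ v, M u v ≤ 1) {y : V → ℝ} (hy : ∀ v, y v ∈ Set.Icc 0 1) (u : V) :
    ∑ v, M u v * y v ∈ Set.Icc 0 1 :=
  ⟨Finset.sum_nonneg fun v _ => mul_nonneg (h0 u v) (hy v).1,
    (Finset.sum_le_sum fun v _ => mul_le_of_le_one_right (h0 u v) (hy v).2).trans (h1 u)⟩

theorem initResponse_mem [DecidableEq V] (hA0 : ∀ k i u v, 0 ≤ A k i u v)
    (hA1 : ∀ k i u, ∑ v, A k i u v ≤ 1) (k : ℕ) (s : ℕ → S) (u v : V) :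
    initResponse A k s u v ∈ Set.Icc 0 1 := by
  induction k generalizing u with
  | zero =>
    rw [initResponse, Matrix.one_apply]
    split_ifs <;> simp
  | succ k ih =>
    rw [initResponse, Matrix.mul_apply]
    exact mulVec_mem_unitInterval (hA0 k _) (hA1 k _) ih u

theorem inputResponse_mem (hA0 : ∀ k i u v, 0 ≤ A k i u v) (hA1 : ∀ k i u, ∑ v, A k i u v ≤ 1)
    (hB : ∀ k i u c, B k i u c ∈ Set.Icc 0 1) (k p : ℕ) (s : ℕ → S) (u : V) (c : K) :
    inputResponse A B k p s u c ∈ Set.Icc 0 1 := by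
  induction k generalizing p u with
  | zero => simp [inputResponse]
  | succ k ih =>
    cases p with
    | zero => exact hB k _ u c
    | succ p =>
      rw [inputResponse, Matrix.mul_apply]
      exact mulVec_mem_unitInterval (hA0 k _) (hA1 k _) (fun v => ih p v) u

theorem initResponse_dependsOn [DecidableEq V] (k : ℕ) :
    DependsOn (initResponse A k) (Set.Iio k) := by
  induction k with
  | zero => exact fun _ _ _ => rfl
  | succ k ih =>
    intro x y h
    rw [initResponse, initResponse, ih fun i hi => h i (by simp at hi ⊢; omega),
      h k (by simp)]

theorem inputResponse_dependsOn (k p : ℕ) : DependsOn (inputResponse A B k p) (Set.Iio k) := by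
  induction k generalizing p with
  | zero => exact fun _ _ _ => rfl
  | succ k ih =>
    intro x y h
    cases p with
    | zero => rw [inputResponse, inputResponse, h k (by simp)]
    | succ p =>
      rw [inputResponse, inputResponse, ih p fun i hi => h i (by simp at hi ⊢; omega),
        h k (by simp)]

theorem inputResponse_eq_zero {k p : ℕ} (h : k ≤ p) (s : ℕ → S) : inputResponse A B k p s = 0 := by
  induction k generalizing p with
  | zero => rfl
  | succ k ih =>
    cases p with
    | zero => omega
    | succ p => rw [inputResponse, ih (by omega), Matrix.mul_zero]

/-- Once the matrices are constant in time, the response is a time-homogeneous functional of the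
recent path. -/
theorem inputResponse_add {k₀ : ℕ} (hA : ∀ k, k₀ ≤ k → A k = A k₀)
    (hB : ∀ k, k₀ ≤ k → B k = B k₀) {j m p : ℕ} (hj : k₀ ≤ j) (hp : p < m) (s : ℕ → S) :
    inputResponse A B (j + m) p s =
      inputResponse (fun _ => A k₀) (fun _ => B k₀) m p fun l => s (j + l) := by
  induction m generalizing p with
  | zero => omega
  | succ m ih =>
    cases p with
    | zero => rw [← add_assoc, inputResponse, inputResponse, hB (j + m) (by omega)]
    | succ p =>
      rw [← add_assoc, inputResponse, inputResponse, hA (j + m) (by omega), ih (by omega)]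

/-- The superposition principle. -/
theorem eq_response [DecidableEq V] [Fintype K] {s : ℕ → S} {e : ℕ → V → ℝ} {ε : ℕ → K → ℝ}
    (he : ∀ k u, e (k + 1) u = ∑ v, A k (s k) u v * e k v + ∑ c, B k (s k) u c * ε k c)
    (k : ℕ) (u : V) :
    e k u = ∑ v, initResponse A k s u v * e 0 v +
      ∑ p ∈ Finset.range k, ∑ c, inputResponse A B k p s u c * ε (k - 1 - p) c := by
  induction k generalizing u with
  | zero => simp [initResponse, Matrix.one_apply]
  | succ k ih =>
    have h1 : ∑ v, initResponse A (k + 1) s u v * e 0 v =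
        ∑ v, A k (s k) u v * ∑ v', initResponse A k s v v' * e 0 v' := by
      simp only [initResponse, Matrix.mul_apply, Finset.sum_mul, Finset.mul_sum]
      rw [Finset.sum_comm]
      simp only [mul_assoc]
    have h2 : ∀ p, ∑ c, inputResponse A B (k + 1) (p + 1) s u c * ε (k + 1 - 1 - (p + 1)) c =
        ∑ v, A k (s k) u v * ∑ c, inputResponse A B k p s v c * ε (k - 1 - p) c := by
      intro p
      simp only [inputResponse, Matrix.mul_apply, Finset.sum_mul, Finset.mul_sum]
      rw [Finset.sum_comm, show k + 1 - 1 - (p + 1) = k - 1 - p by omega]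
      simp only [mul_assoc]
    rw [he, Finset.sum_range_succ', h1, Finset.sum_congr rfl fun p _ => h2 p, Finset.sum_comm]
    simp only [ih, mul_add, Finset.sum_add_distrib, Finset.mul_sum, inputResponse]
    simp only [Nat.add_sub_cancel, Nat.sub_zero]
    ring

end Response

section Decay

variable {Ω : Type*} [MeasurableSpace Ω] {μ : Measure Ω} [IsProbabilityMeasure μ] {N : ℕ}
  {P : Matrix (Fin N) (Fin N) ℝ} {θ : ℕ → Ω → Fin N} {V K : Type*} [Fintype V]
  {A : ℕ → Fin N → Matrix V V ℝ} {B : ℕ → Fin N → Matrix V K ℝ}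

theorem IsMarkovChain.tendsto_integral_initResponse [DecidableEq V] (hθ : IsMarkovChain P θ μ)
    (hP : IsErgodic P) (hd : ∀ i, 0 < P i i) (hA0 : ∀ k i u v, 0 ≤ A k i u v)
    (hA1 : ∀ k i u, ∑ v, A k i u v ≤ 1) {k₀ : ℕ} (hA : ∀ k, k₀ ≤ k → A k = A k₀)
    (hleak : IsLeaky (A k₀)) (u v : V) :
    Tendsto (fun k => ∫ ω, initResponse A k (fun l => θ l ω) u v ∂μ) atTop (𝓝 0) := by
  obtain ⟨C, r, hC, hr0, hr1, hb⟩ := hθ.exists_integral_le hP hd hleak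
  have h := hb k₀ (fun n s u => initResponse A (k₀ + n) s u v)
    (fun u x y h => by dsimp only; rw [add_zero, initResponse_dependsOn k₀ h])
    (fun s u => (initResponse_mem hA0 hA1 _ s u v).2)
    (fun n s u => by
      rw [← add_assoc, initResponse, Matrix.mul_apply, hA (k₀ + n) (by omega)])
  rw [← tendsto_add_atTop_iff_nat k₀]
  refine squeeze_zero (fun n => integral_nonneg fun ω => (initResponse_mem hA0 hA1 _ _ u v).1)
    (fun n => (add_comm k₀ n ▸ h n u : _)) ?_
  simpa using (tendsto_pow_atTop_nhds_zero_of_lt_one hr0.le hr1).const_mul C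

/-- The mean response to an input decays exponentially in the age of the input. The bound is
stated as a square, since correlations are controlled by geometric means of two such bounds. -/
theorem IsMarkovChain.exists_integral_inputResponse_le (hθ : IsMarkovChain P θ μ)
    (hP : IsErgodic P) (hd : ∀ i, 0 < P i i) (hA0 : ∀ k i u v, 0 ≤ A k i u v)
    (hA1 : ∀ k i u, ∑ v, A k i u v ≤ 1) (hB01 : ∀ k i u c, B k i u c ∈ Set.Icc 0 1)
    {k₀ : ℕ} (hA : ∀ k, k₀ ≤ k → A k = A k₀) (hleak : IsLeaky (A k₀)) :
    ∃ γ : ℕ → ℝ, Summable γ ∧ (∀ p, 0 ≤ γ p) ∧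
      ∀ k p u c, ∫ ω, inputResponse A B k p (fun l => θ l ω) u c ∂μ ≤ γ p ^ 2 := by
  obtain ⟨C, r, hC, hr0, hr1, hb⟩ := hθ.exists_integral_le hP hd hleak
  -- the exponent is truncated at zero: there is no decay before time `k₀`
  refine ⟨fun p => √(C + 1) * √r ^ (p - k₀), ?_, fun p => by positivity, fun k p u c => ?_⟩
  · rw [← summable_nat_add_iff k₀]
    simp only [Nat.add_sub_cancel]
    refine (summable_geometric_of_lt_one (Real.sqrt_nonneg r) ?_).mul_left _
    rw [Real.sqrt_lt' one_pos]
    simpa using hr1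
  · have hsq : (√(C + 1) * √r ^ (p - k₀)) ^ 2 = (C + 1) * r ^ (p - k₀) := by
      rw [mul_pow, Real.sq_sqrt (by positivity), ← pow_mul, mul_comm _ 2, pow_mul,
        Real.sq_sqrt hr0.le]
    dsimp only
    rw [hsq]
    have hmem := inputResponse_mem hA0 hA1 hB01
    rcases le_or_gt k p with hkp | hkp
    · simp only [inputResponse_eq_zero hkp, Matrix.zero_apply, integral_zero]
      positivity
    rcases le_or_gt k₀ p with hp | hp
    · have h := hb (k - p + k₀) (fun n s u => inputResponse A B (k - p + k₀ + n) (k₀ + n) s u c)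
        (fun u x y h => by dsimp only; rw [add_zero, inputResponse_dependsOn _ _ h])
        (fun s u => (hmem _ _ s u c).2)
        (fun n s u => by
          rw [← add_assoc, ← add_assoc, inputResponse, Matrix.mul_apply, hA _ (by omega)])
        (p - k₀) u
      rw [show k - p + k₀ + (p - k₀) = k by omega, show k₀ + (p - k₀) = p by omega] at h
      exact h.trans (by gcongr; linarith)
    · rw [show p - k₀ = 0 by omega, pow_zero, mul_one]
      calc _ ≤ ∫ _, (1 : ℝ) ∂μ :=
            integral_mono_of_nonneg (ae_of_all _ fun ω => (hmem _ _ _ u c).1)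
              (integrable_const _) (ae_of_all _ fun ω => (hmem _ _ _ u c).2)
        _ ≤ C + 1 := by simpa using hC

/-- The joint moments of the responses to inputs of fixed ages converge, because they are
determined by the joint law of finitely many consecutive states. -/
theorem IsMarkovChain.exists_tendsto_integral_inputResponse_mul (hθ : IsMarkovChain P θ μ)
    (hP : IsErgodic P) (hd : ∀ i, 0 < P i i) {k₀ : ℕ} (hA : ∀ k, k₀ ≤ k → A k = A k₀)
    (hB : ∀ k, k₀ ≤ k → B k = B k₀) (p q : ℕ) (u u' : V) (c c' : K) :
    ∃ L, Tendsto (fun k => ∫ ω, inputResponse A B k p (fun l => θ l ω) u c *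
      inputResponse A B k q (fun l => θ l ω) u' c' ∂μ) atTop (𝓝 L) := by
  set m := max p q
  set F : (ℕ → Fin N) → ℝ := fun s =>
    inputResponse (fun _ => A k₀) (fun _ => B k₀) (m + 1) p s u c *
      inputResponse (fun _ => A k₀) (fun _ => B k₀) (m + 1) q s u' c'
  have hF : DependsOn F (Set.Iic m) := by
    intro x y h
    have h' : ∀ i ∈ Set.Iio (m + 1), x i = y i := fun i hi => h i (by simp at hi ⊢; omega)
    simp only [F]
    rw [inputResponse_dependsOn _ p h', inputResponse_dependsOn _ q h']
  obtain ⟨L, hL⟩ := hθ.exists_tendsto_integral_shift hP hd m hF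
  refine ⟨L, (tendsto_add_atTop_iff_nat (m + 1)).1 (hL.congr' ?_)⟩
  filter_upwards [eventually_ge_atTop k₀] with j hj
  congr 1 with ω
  rw [inputResponse_add hA hB hj (show p < m + 1 by omega),
    inputResponse_add hA hB hj (show q < m + 1 by omega)]

theorem IsMarkovChain.exists_tendsto_integral_inputResponse (hθ : IsMarkovChain P θ μ)
    (hP : IsErgodic P) (hd : ∀ i, 0 < P i i) {k₀ : ℕ} (hA : ∀ k, k₀ ≤ k → A k = A k₀)
    (hB : ∀ k, k₀ ≤ k → B k = B k₀) (p : ℕ) (u : V) (c : K) :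
    ∃ L, Tendsto (fun k => ∫ ω, inputResponse A B k p (fun l => θ l ω) u c ∂μ) atTop (𝓝 L) := by
  set F : (ℕ → Fin N) → ℝ := fun s =>
    inputResponse (fun _ => A k₀) (fun _ => B k₀) (p + 1) p s u c
  have hF : DependsOn F (Set.Iic p) := by
    intro x y h
    have h' : ∀ i ∈ Set.Iio (p + 1), x i = y i := fun i hi => h i (by simp at hi ⊢; omega)
    simp only [F]
    rw [inputResponse_dependsOn _ p h']
  obtain ⟨L, hL⟩ := hθ.exists_tendsto_integral_shift hP hd p hF
  refine ⟨L, (tendsto_add_atTop_iff_nat (p + 1)).1 (hL.congr' ?_)⟩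
  filter_upwards [eventually_ge_atTop k₀] with j hj
  congr 1 with ω
  rw [inputResponse_add hA hB hj (Nat.lt_succ_self p)]

end Decay

/-! ### Convergence of the first two moments -/

/-- Tannery's theorem for partial sums. -/
theorem exists_tendsto_sum_range {f : ℕ → ℕ → ℝ} {b : ℕ → ℝ} (hb : Summable b)
    (hfb : ∀ k p, |f k p| ≤ b p) (hf : ∀ p, ∃ L, Tendsto (fun k => f k p) atTop (𝓝 L)) :
    ∃ L, Tendsto (fun k => ∑ p ∈ Finset.range k, f k p) atTop (𝓝 L) := by
  choose L hL using hf
  refine ⟨_, Tendsto.congr (fun k => (sum_eq_tsum_indicator (f k) (Finset.range k)).symm)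
    (tendsto_tsum_of_dominated_convergence (g := L) hb (fun p => ?_)
      (Eventually.of_forall fun k p => ?_))⟩
  · refine (hL p).congr' ?_
    filter_upwards [eventually_gt_atTop p] with k hk
    rw [Set.indicator_of_mem (by simpa using hk)]
  · exact (norm_indicator_le_norm_self _ _).trans (hfb k p)

/-- The Cauchy–Schwarz inequality. -/
theorem abs_integral_mul_le {Ω : Type*} [MeasurableSpace Ω] {μ : Measure Ω} {f g : Ω → ℝ}
    (hf : MemLp f 2 μ) (hg : MemLp g 2 μ) :
    |∫ ω, f ω * g ω ∂μ| ≤ √(∫ ω, f ω * f ω ∂μ) * √(∫ ω, g ω * g ω ∂μ) := by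
  have h := integral_mul_norm_le_Lp_mul_Lq (μ := μ) (f := f) (g := g) Real.HolderConjugate.two_two
    (by simpa using hf) (by simpa using hg)
  simp only [Real.rpow_two, Real.norm_eq_abs, sq_abs, ← Real.sqrt_eq_rpow] at h
  simp only [← sq]
  refine (abs_integral_le_integral_abs).trans ?_
  simpa only [abs_mul] using h

/-- The correlation of a process that vanishes in mean square with a process that is bounded in
mean square vanishes. -/
theorem tendsto_integral_mul_of_tendsto_zero {Ω : Type*} [MeasurableSpace Ω] {μ : Measure Ω}
    {f g : ℕ → Ω → ℝ} (hf : ∀ k, MemLp (f k) 2 μ) (hg : ∀ k, MemLp (g k) 2 μ)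
    (hf0 : Tendsto (fun k => ∫ ω, f k ω * f k ω ∂μ) atTop (𝓝 0)) {L : ℝ}
    (hgL : Tendsto (fun k => ∫ ω, g k ω * g k ω ∂μ) atTop (𝓝 L)) :
    Tendsto (fun k => ∫ ω, f k ω * g k ω ∂μ) atTop (𝓝 0) := by
  refine squeeze_zero_norm (fun k => abs_integral_mul_le (hf k) (hg k)) ?_
  simpa using hf0.sqrt.mul hgL.sqrt

theorem IsWideSenseStationary.abs_correlation_le {Ω K : Type*} [MeasurableSpace Ω]
    {μ : Measure Ω} {ε : ℕ → K → Ω → ℝ} (hε : IsWideSenseStationary ε μ) (k l : ℕ) (c d : K) :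
    |∫ ω, ε k c ω * ε l d ω ∂μ| ≤
      √(∫ ω, ε 0 c ω * ε 0 c ω ∂μ) * √(∫ ω, ε 0 d ω * ε 0 d ω ∂μ) := by
  have h : ∀ k c, ∫ ω, ε k c ω * ε k c ω ∂μ = ∫ ω, ε 0 c ω * ε 0 c ω ∂μ := fun k c => by
    simpa using hε.correlation 0 0 k c c
  rw [← h k c, ← h l d]
  exact abs_integral_mul_le (hε.memLp k c) (hε.memLp l d)

section Moments

variable {Ω : Type*} [MeasurableSpace Ω] {μ : Measure Ω} {N : ℕ}
  {P : Matrix (Fin N) (Fin N) ℝ} {θ : ℕ → Ω → Fin N}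

theorem IsMarkovChain.memLp_mul (hθ : IsMarkovChain P θ μ) {F : (ℕ → Fin N) → ℝ} {t : Set ℕ}
    (ht : t.Finite) (hF : DependsOn F t) {Z : Ω → ℝ} {p : ENNReal} (hZ : MemLp Z p μ) :
    MemLp (fun ω => F (fun k => θ k ω) * Z ω) p μ :=
  hZ.mul' (hθ.memLp_comp ht hF)

theorem IsMarkovChain.integral_mul_indep (hθ : IsMarkovChain P θ μ) {F : (ℕ → Fin N) → ℝ}
    {t : Set ℕ} (ht : t.Finite) (hF : DependsOn F t) {Z : Ω → ℝ} (hZ : AEMeasurable Z μ)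
    (hind : IndepFun Z (fun ω k => θ k ω) μ) :
    ∫ ω, F (fun k => θ k ω) * Z ω ∂μ = (∫ ω, F (fun k => θ k ω) ∂μ) * ∫ ω, Z ω ∂μ :=
  hind.symm.integral_fun_comp_mul_comp (f := F) (g := id) hθ.measurable_path.aemeasurable
    hZ (measurable_of_dependsOn ht hF).aestronglyMeasurable measurable_id.aestronglyMeasurable

/-- The mean of a linear combination of random variables that are independent of the chain, with
coefficients that are determined by finitely many steps of the chain. -/
theorem IsMarkovChain.integral_sum_mul_indep (hθ : IsMarkovChain P θ μ) {I : Type*}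
    (J : Finset I) {F : I → (ℕ → Fin N) → ℝ} {Z : I → Ω → ℝ} {t : Set ℕ} (ht : t.Finite)
    (hF : ∀ i, DependsOn (F i) t) (hZ : ∀ i, Integrable (Z i) μ)
    (hind : ∀ i, IndepFun (Z i) (fun ω k => θ k ω) μ) :
    ∫ ω, ∑ i ∈ J, F i (fun k => θ k ω) * Z i ω ∂μ =
      ∑ i ∈ J, (∫ ω, F i (fun k => θ k ω) ∂μ) * ∫ ω, Z i ω ∂μ := by
  rw [integral_finsetSum _ fun i _ => memLp_one_iff_integrable.1
    (hθ.memLp_mul ht (hF i) (memLp_one_iff_integrable.2 (hZ i)))]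
  exact Finset.sum_congr rfl fun i _ => hθ.integral_mul_indep ht (hF i) (hZ i).aemeasurable (hind i)

/-- The correlation of two such linear combinations. -/
theorem IsMarkovChain.integral_sum_mul_sum_mul_indep (hθ : IsMarkovChain P θ μ) {I : Type*}
    (J : Finset I) {F F' : I → (ℕ → Fin N) → ℝ} {Z : I → Ω → ℝ} {t : Set ℕ} (ht : t.Finite)
    (hF : ∀ i, DependsOn (F i) t) (hF' : ∀ i, DependsOn (F' i) t) (hZ : ∀ i, MemLp (Z i) 2 μ)
    (hind : ∀ i j, IndepFun (fun ω => Z i ω * Z j ω) (fun ω k => θ k ω) μ) :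
    ∫ ω, (∑ i ∈ J, F i (fun k => θ k ω) * Z i ω) * (∑ j ∈ J, F' j (fun k => θ k ω) * Z j ω) ∂μ =
      ∑ i ∈ J, ∑ j ∈ J,
        (∫ ω, F i (fun k => θ k ω) * F' j (fun k => θ k ω) ∂μ) * ∫ ω, Z i ω * Z j ω ∂μ := by
  have h := hθ.integral_sum_mul_indep (J ×ˢ J) (F := fun x s => F x.1 s * F' x.2 s)
    (Z := fun x ω => Z x.1 ω * Z x.2 ω) ht
    (fun x y z h => by dsimp only; rw [hF x.1 h, hF' x.2 h])
    (fun x => (hZ x.1).integrable_mul (hZ x.2)) (fun x => hind x.1 x.2)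
  simp only [Finset.sum_product] at h
  rw [← h]
  congr 1 with ω
  rw [Finset.sum_mul_sum]
  exact Finset.sum_congr rfl fun i _ => Finset.sum_congr rfl fun j _ => by ring

variable {V K : Type*} [Fintype V]
  {A : ℕ → Fin N → Matrix V V ℝ} {B : ℕ → Fin N → Matrix V K ℝ}

/-- The part of the solution of a driven linear recursion that stems from the initial
condition. -/
noncomputable def initPart [DecidableEq V] (A : ℕ → Fin N → Matrix V V ℝ) (θ : ℕ → Ω → Fin N)
    (x0 : V → Ω → ℝ) (k : ℕ) (u : V) (ω : Ω) : ℝ :=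
  ∑ v, initResponse A k (fun l => θ l ω) u v * x0 v ω

/-- The part of the solution of a driven linear recursion that stems from the input. -/
noncomputable def inputPart [Fintype K] (A : ℕ → Fin N → Matrix V V ℝ)
    (B : ℕ → Fin N → Matrix V K ℝ) (θ : ℕ → Ω → Fin N) (ε : ℕ → K → Ω → ℝ) (k : ℕ) (u : V)
    (ω : Ω) : ℝ :=
  ∑ x ∈ Finset.range k ×ˢ Finset.univ,
    inputResponse A B k x.1 (fun l => θ l ω) u x.2 * ε (k - 1 - x.1) x.2 ω

theorem IsMarkovChain.memLp_initPart [DecidableEq V] (hθ : IsMarkovChain P θ μ)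
    {x0 : V → Ω → ℝ} (hx0 : ∀ v, MemLp (x0 v) 2 μ) (k : ℕ) (u : V) :
    MemLp (initPart A θ x0 k u) 2 μ :=
  memLp_finsetSum _ fun v _ => hθ.memLp_mul (F := fun s => initResponse A k s u v)
    (Set.finite_Iio k) (fun x y h => by dsimp only; rw [initResponse_dependsOn k h]) (hx0 v)

theorem IsMarkovChain.memLp_inputPart [Fintype K] (hθ : IsMarkovChain P θ μ)
    {ε : ℕ → K → Ω → ℝ} (hε : IsWideSenseStationary ε μ) (k : ℕ) (u : V) :
    MemLp (inputPart A B θ ε k u) 2 μ :=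
  memLp_finsetSum _ fun x _ => hθ.memLp_mul (F := fun s => inputResponse A B k x.1 s u x.2)
    (Set.finite_Iio k) (fun y z h => by dsimp only; rw [inputResponse_dependsOn k x.1 h])
    (hε.memLp _ _)

variable [IsProbabilityMeasure μ]

/-- The influence of the initial condition vanishes in mean square. -/
theorem IsMarkovChain.tendsto_initPart [DecidableEq V] (hθ : IsMarkovChain P θ μ)
    (hP : IsErgodic P) (hd : ∀ i, 0 < P i i) (hA0 : ∀ k i u v, 0 ≤ A k i u v)
    (hA1 : ∀ k i u, ∑ v, A k i u v ≤ 1) {k₀ : ℕ} (hA : ∀ k, k₀ ≤ k → A k = A k₀)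
    (hleak : IsLeaky (A k₀)) {x0 : V → Ω → ℝ} (hx0 : ∀ v, MemLp (x0 v) 2 μ)
    (hind : IndepFun (fun ω v => x0 v ω) (fun ω k => θ k ω) μ) (u : V) :
    Tendsto (fun k => ∫ ω, initPart A θ x0 k u ω * initPart A θ x0 k u ω ∂μ) atTop (𝓝 0) := by
  have hdep : ∀ k v, DependsOn (fun s => initResponse A k s u v) (Set.Iio k) :=
    fun k v x y h => by dsimp only; rw [initResponse_dependsOn k h]
  have hmem := initResponse_mem hA0 hA1
  have h : ∀ k, ∫ ω, initPart A θ x0 k u ω * initPart A θ x0 k u ω ∂μ = _ := fun k =>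
    hθ.integral_sum_mul_sum_mul_indep Finset.univ (Set.finite_Iio k) (hdep k) (hdep k) hx0
      fun v v' => hind.comp (φ := fun y : V → ℝ => y v * y v')
        ((measurable_pi_apply v).mul (measurable_pi_apply v')) measurable_id
  simp only [h]
  rw [← Finset.sum_const_zero (s := (Finset.univ : Finset V))]
  refine tendsto_finsetSum _ fun v _ => ?_
  rw [← Finset.sum_const_zero (s := (Finset.univ : Finset V))]
  refine tendsto_finsetSum _ fun v' _ => ?_
  rw [← zero_mul (∫ ω, x0 v ω * x0 v' ω ∂μ)]
  refine Tendsto.mul_const _ (squeeze_zero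
    (fun k => integral_nonneg fun ω => mul_nonneg (hmem k _ u v).1 (hmem k _ u v').1)
    (fun k => integral_mono_of_nonneg
      (ae_of_all _ fun ω => mul_nonneg (hmem k _ u v).1 (hmem k _ u v').1)
      (hθ.integrable_comp (Set.finite_Iio k) (hdep k v))
      (ae_of_all _ fun ω => mul_le_of_le_one_right (hmem k _ u v).1 (hmem k _ u v').2))
    (hθ.tendsto_integral_initResponse hP hd hA0 hA1 hA hleak u v))

/-- The influence of the initial condition vanishes in mean. -/
theorem IsMarkovChain.tendsto_initPart_mean [DecidableEq V] (hθ : IsMarkovChain P θ μ)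
    (hP : IsErgodic P) (hd : ∀ i, 0 < P i i) (hA0 : ∀ k i u v, 0 ≤ A k i u v)
    (hA1 : ∀ k i u, ∑ v, A k i u v ≤ 1) {k₀ : ℕ} (hA : ∀ k, k₀ ≤ k → A k = A k₀)
    (hleak : IsLeaky (A k₀)) {x0 : V → Ω → ℝ} (hx0 : ∀ v, MemLp (x0 v) 2 μ)
    (hind : IndepFun (fun ω v => x0 v ω) (fun ω k => θ k ω) μ) (u : V) :
    Tendsto (fun k => ∫ ω, initPart A θ x0 k u ω ∂μ) atTop (𝓝 0) := by
  have h := tendsto_integral_mul_of_tendsto_zero (L := 1)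
    (fun k => hθ.memLp_initPart hx0 k u) (fun _ => memLp_const (1 : ℝ))
    (hθ.tendsto_initPart hP hd hA0 hA1 hA hleak hx0 hind u) (by simp)
  simpa using h

theorem IsMarkovChain.exists_tendsto_inputPart_mean [Fintype K] (hθ : IsMarkovChain P θ μ)
    (hP : IsErgodic P) (hd : ∀ i, 0 < P i i) (hA0 : ∀ k i u v, 0 ≤ A k i u v)
    (hA1 : ∀ k i u, ∑ v, A k i u v ≤ 1) (hB01 : ∀ k i u c, B k i u c ∈ Set.Icc 0 1) {k₀ : ℕ}
    (hA : ∀ k, k₀ ≤ k → A k = A k₀) (hB : ∀ k, k₀ ≤ k → B k = B k₀)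
    (hleak : IsLeaky (A k₀)) {ε : ℕ → K → Ω → ℝ} (hε : IsWideSenseStationary ε μ)
    (hind : IndepFun (fun ω k c => ε k c ω) (fun ω k => θ k ω) μ) (u : V) :
    ∃ L, Tendsto (fun k => ∫ ω, inputPart A B θ ε k u ω ∂μ) atTop (𝓝 L) := by
  obtain ⟨γ, hγ, hγ0, hb⟩ :=
    hθ.exists_integral_inputResponse_le hP hd hA0 hA1 hB01 hA hleak
  have hmem := inputResponse_mem hA0 hA1 hB01
  have h : ∀ k, ∫ ω, inputPart A B θ ε k u ω ∂μ = ∑ p ∈ Finset.range k, ∑ c,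
      (∫ ω, inputResponse A B k p (fun l => θ l ω) u c ∂μ) * ∫ ω, ε 0 c ω ∂μ := by
    intro k
    refine (hθ.integral_sum_mul_indep (Finset.range k ×ˢ Finset.univ)
      (F := fun x s => inputResponse A B k x.1 s u x.2)
      (Z := fun x => ε (k - 1 - x.1) x.2) (Set.finite_Iio k)
      (fun x y z h => by dsimp only; rw [inputResponse_dependsOn k x.1 h])
      (fun x => (hε.memLp _ _).integrable one_le_two)
      (fun x => hind.comp (φ := fun y : ℕ → K → ℝ => y (k - 1 - x.1) x.2)
        (by fun_prop) measurable_id)).trans ?_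
    rw [Finset.sum_product]
    simp only [fun l => hε.mean l 0]
  simp only [h]
  -- the bound `γ p ^ 2` is weakened to `γ p * ∑' q, γ q`, which is clearly summable
  refine exists_tendsto_sum_range (b := fun p => γ p * (∑ c, ((∑' q, γ q) * |∫ ω, ε 0 c ω ∂μ|)))
    (hγ.mul_right _) (fun k p => ?_) (fun p => ?_)
  · rw [Finset.mul_sum]
    refine (Finset.abs_sum_le_sum_abs _ _).trans (Finset.sum_le_sum fun c _ => ?_)
    rw [abs_mul, ← mul_assoc]
    refine mul_le_mul_of_nonneg_right ?_ (abs_nonneg _)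
    rw [abs_of_nonneg (integral_nonneg fun ω => (hmem k p _ u c).1)]
    refine (hb k p u c).trans ?_
    rw [sq]
    exact mul_le_mul_of_nonneg_left (hγ.le_tsum p fun q _ => hγ0 q) (hγ0 p)
  · choose L hL using fun c =>
      hθ.exists_tendsto_integral_inputResponse hP hd hA hB p u c
    exact ⟨_, tendsto_finsetSum _ fun c _ => (hL c).mul_const _⟩

theorem IsMarkovChain.exists_tendsto_inputPart_correlation [Fintype K]
    (hθ : IsMarkovChain P θ μ)
    (hP : IsErgodic P) (hd : ∀ i, 0 < P i i) (hA0 : ∀ k i u v, 0 ≤ A k i u v)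
    (hA1 : ∀ k i u, ∑ v, A k i u v ≤ 1) (hB01 : ∀ k i u c, B k i u c ∈ Set.Icc 0 1) {k₀ : ℕ}
    (hA : ∀ k, k₀ ≤ k → A k = A k₀) (hB : ∀ k, k₀ ≤ k → B k = B k₀)
    (hleak : IsLeaky (A k₀)) {ε : ℕ → K → Ω → ℝ} (hε : IsWideSenseStationary ε μ)
    (hind : IndepFun (fun ω k c => ε k c ω) (fun ω k => θ k ω) μ) (u u' : V) :
    ∃ L, Tendsto (fun k => ∫ ω, inputPart A B θ ε k u ω * inputPart A B θ ε k u' ω ∂μ)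
      atTop (𝓝 L) := by
  obtain ⟨γ, hγ, hγ0, hb⟩ :=
    hθ.exists_integral_inputResponse_le hP hd hA0 hA1 hB01 hA hleak
  have hmem := inputResponse_mem hA0 hA1 hB01
  have hdep : ∀ k p u c, DependsOn (fun s => inputResponse A B k p s u c) (Set.Iio k) :=
    fun k p u c y z h => by dsimp only; rw [inputResponse_dependsOn k p h]
  set f : ℕ → ℕ → ℕ → ℝ := fun k p q => ∑ c, ∑ d,
    (∫ ω, inputResponse A B k p (fun l => θ l ω) u c *
      inputResponse A B k q (fun l => θ l ω) u' d ∂μ) *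
        ∫ ω, ε (k - 1 - p) c ω * ε (k - 1 - q) d ω ∂μ
  have h : ∀ k, ∫ ω, inputPart A B θ ε k u ω * inputPart A B θ ε k u' ω ∂μ =
      ∑ p ∈ Finset.range k, ∑ q ∈ Finset.range k, f k p q := by
    intro k
    refine (hθ.integral_sum_mul_sum_mul_indep (Finset.range k ×ˢ Finset.univ)
      (F := fun x s => inputResponse A B k x.1 s u x.2)
      (F' := fun x s => inputResponse A B k x.1 s u' x.2)
      (Z := fun x => ε (k - 1 - x.1) x.2) (Set.finite_Iio k)
      (fun x => hdep k _ _ _) (fun x => hdep k _ _ _) (fun x => hε.memLp _ _)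
      (fun x x' => hind.comp (φ := fun y : ℕ → K → ℝ =>
        y (k - 1 - x.1) x.2 * y (k - 1 - x'.1) x'.2) (by fun_prop) measurable_id)).trans ?_
    simp only [Finset.sum_product, f]
    refine Finset.sum_congr rfl fun p _ => ?_
    rw [Finset.sum_comm]
  simp only [h]
  set D : ℝ := ∑ c, ∑ d, √(∫ ω, ε 0 c ω * ε 0 c ω ∂μ) * √(∫ ω, ε 0 d ω * ε 0 d ω ∂μ)
  -- the mean of a product of responses is at most each of the two means, since responses
  -- are at most one, and hence at most their geometric mean
  have hprod : ∀ k p q c d, |∫ ω, inputResponse A B k p (fun l => θ l ω) u c *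
      inputResponse A B k q (fun l => θ l ω) u' d ∂μ| ≤ γ p * γ q := by
    intro k p q c d
    rw [abs_of_nonneg (integral_nonneg fun ω => mul_nonneg (hmem k p _ u c).1 (hmem k q _ u' d).1)]
    have hp := (integral_mono_of_nonneg
      (ae_of_all μ fun ω => mul_nonneg (hmem k p (fun l => θ l ω) u c).1
        (hmem k q (fun l => θ l ω) u' d).1)
      (hθ.integrable_comp (Set.finite_Iio k) (hdep k p u c))
      (ae_of_all _ fun ω => mul_le_of_le_one_right (hmem k p _ u c).1
        (hmem k q _ u' d).2)).trans (hb k p u c)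
    have hq := (integral_mono_of_nonneg
      (ae_of_all μ fun ω => mul_nonneg (hmem k p (fun l => θ l ω) u c).1
        (hmem k q (fun l => θ l ω) u' d).1)
      (hθ.integrable_comp (Set.finite_Iio k) (hdep k q u' d))
      (ae_of_all _ fun ω => mul_le_of_le_one_left (hmem k q _ u' d).1
        (hmem k p _ u c).2)).trans (hb k q u' d)
    rcases le_total (γ p) (γ q) with hle | hle
    · exact hp.trans (by rw [sq]; exact mul_le_mul_of_nonneg_left hle (hγ0 p))
    · exact hq.trans (by rw [sq]; exact mul_le_mul_of_nonneg_right hle (hγ0 q))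
  have hf : ∀ k p q, |f k p q| ≤ γ p * D * γ q := by
    intro k p q
    rw [mul_right_comm]
    simp only [D, Finset.mul_sum]
    refine (Finset.abs_sum_le_sum_abs _ _).trans (Finset.sum_le_sum fun c _ => ?_)
    refine (Finset.abs_sum_le_sum_abs _ _).trans (Finset.sum_le_sum fun d _ => ?_)
    rw [abs_mul]
    exact mul_le_mul (hprod k p q c d) (hε.abs_correlation_le _ _ _ _) (abs_nonneg _)
      (mul_nonneg (hγ0 p) (hγ0 q))
  have hD : 0 ≤ D := Finset.sum_nonneg fun c _ => Finset.sum_nonneg fun d _ => by positivity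
  refine exists_tendsto_sum_range (b := fun p => γ p * (D * ∑' q, γ q)) (hγ.mul_right _)
    (fun k p => ?_) (fun p => ?_)
  · calc |∑ q ∈ Finset.range k, f k p q| ≤ ∑ q ∈ Finset.range k, γ p * D * γ q :=
          (Finset.abs_sum_le_sum_abs _ _).trans (Finset.sum_le_sum fun q _ => hf k p q)
      _ = γ p * D * ∑ q ∈ Finset.range k, γ q := (Finset.mul_sum _ _ _).symm
      _ ≤ γ p * D * ∑' q, γ q :=
          mul_le_mul_of_nonneg_left (hγ.sum_le_tsum _ fun q _ => hγ0 q)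
            (mul_nonneg (hγ0 p) hD)
      _ = γ p * (D * ∑' q, γ q) := mul_assoc _ _ _
  · refine exists_tendsto_sum_range (hγ.mul_left (γ p * D)) (fun k q => hf k p q) fun q => ?_
    choose L hL using fun c d =>
      hθ.exists_tendsto_integral_inputResponse_mul hP hd hA hB p q u u' c d
    refine ⟨∑ c, ∑ d, L c d *
      ∫ ω, ε (max p q - p) c ω * ε (max p q - q) d ω ∂μ, ?_⟩
    refine tendsto_finsetSum _ fun c _ => tendsto_finsetSum _ fun d _ =>
      (hL c d).mul (tendsto_const_nhds.congr' ?_)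
    -- by stationarity, the correlation of the inputs only depends on their ages
    filter_upwards [eventually_gt_atTop (max p q)] with k hk
    rw [← hε.correlation (max p q - p) (max p q - q) (k - 1 - max p q) c d,
      show max p q - p + (k - 1 - max p q) = k - 1 - p by omega,
      show max p q - q + (k - 1 - max p q) = k - 1 - q by omega]

/-- A linear recursion driven by an ergodic chain, with leaky matrices and wide sense stationary
input, is mean square convergent, to a limit that does not depend on the initial condition. -/
theorem IsMarkovChain.exists_hasMeanSquareLimit [Fintype K] (hθ : IsMarkovChain P θ μ)
    (hP : IsErgodic P) (hd : ∀ i, 0 < P i i) (hA0 : ∀ k i u v, 0 ≤ A k i u v)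
    (hA1 : ∀ k i u, ∑ v, A k i u v ≤ 1) (hB01 : ∀ k i u c, B k i u c ∈ Set.Icc 0 1) {k₀ : ℕ}
    (hA : ∀ k, k₀ ≤ k → A k = A k₀) (hB : ∀ k, k₀ ≤ k → B k = B k₀)
    (hleak : IsLeaky (A k₀)) {ε : ℕ → K → Ω → ℝ} (hε : IsWideSenseStationary ε μ)
    (hind : IndepFun (fun ω k c => ε k c ω) (fun ω k => θ k ω) μ) :
    ∃ (m : V → ℝ) (Q : Matrix V V ℝ), ∀ e : ℕ → V → Ω → ℝ,
      (∀ u, MemLp (e 0 u) 2 μ) → IndepFun (fun ω u => e 0 u ω) (fun ω k => θ k ω) μ →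
      (∀ k u ω, e (k + 1) u ω =
        ∑ v, A k (θ k ω) u v * e k v ω + ∑ c, B k (θ k ω) u c * ε k c ω) →
      HasMeanSquareLimit e m Q μ := by
  classical
  choose m hm using
    hθ.exists_tendsto_inputPart_mean hP hd hA0 hA1 hB01 hA hB hleak hε hind
  choose Q hQ using
    hθ.exists_tendsto_inputPart_correlation hP hd hA0 hA1 hB01 hA hB hleak hε hind
  refine ⟨m, Q, fun e he0 hind0 he => ?_⟩
  have hrepr : ∀ k u, e k u = fun ω => initPart A θ (e 0) k u ω + inputPart A B θ ε k u ω := by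
    intro k u
    ext ω
    rw [initPart, inputPart, Finset.sum_product]
    exact eq_response (s := fun l => θ l ω) (e := fun k u => e k u ω)
      (ε := fun k c => ε k c ω) (fun k u => he k u ω) k u
  have hI := hθ.memLp_initPart (A := A) he0
  have hS := hθ.memLp_inputPart (A := A) (B := B) hε
  have hI0 := hθ.tendsto_initPart hP hd hA0 hA1 hA hleak he0 hind0
  constructor
  · intro k u
    rw [hrepr]
    exact (hI k u).add (hS k u)
  · intro u
    have h : ∀ k, ∫ ω, e k u ω ∂μ =
        ∫ ω, initPart A θ (e 0) k u ω ∂μ + ∫ ω, inputPart A B θ ε k u ω ∂μ := by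
      intro k
      rw [hrepr, integral_add ((hI k u).integrable one_le_two) ((hS k u).integrable one_le_two)]
    simp only [h]
    simpa using (hθ.tendsto_initPart_mean hP hd hA0 hA1 hA hleak he0 hind0 u).add (hm u)
  · intro u v
    have h : ∀ k, ∫ ω, e k u ω * e k v ω ∂μ =
        ∫ ω, initPart A θ (e 0) k u ω * initPart A θ (e 0) k v ω ∂μ +
        ∫ ω, initPart A θ (e 0) k u ω * inputPart A B θ ε k v ω ∂μ +
        (∫ ω, initPart A θ (e 0) k v ω * inputPart A B θ ε k u ω ∂μ +
        ∫ ω, inputPart A B θ ε k u ω * inputPart A B θ ε k v ω ∂μ) := by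
      intro k
      have h1 := (hI k u).integrable_mul (hI k v)
      have h2 := (hI k u).integrable_mul (hS k v)
      have h3 := (hI k v).integrable_mul (hS k u)
      have h4 := (hS k u).integrable_mul (hS k v)
      have hsum := integral_add' (h1.add h2) (h3.add h4)
      rw [integral_add' h1 h2, integral_add' h3 h4] at hsum
      refine Eq.trans ?_ hsum
      congr 1 with ω
      simp only [hrepr, Pi.add_apply, Pi.mul_apply]
      ring
    simp only [h]
    have t1 := tendsto_integral_mul_of_tendsto_zero (fun k => hI k u) (fun k => hI k v)
      (hI0 u) (hI0 v)
    have t2 := tendsto_integral_mul_of_tendsto_zero (fun k => hI k u) (fun k => hS k v)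
      (hI0 u) (hQ v v)
    have t3 := tendsto_integral_mul_of_tendsto_zero (fun k => hI k v) (fun k => hS k u)
      (hI0 v) (hQ u u)
    simpa using (t1.add t2).add (t3.add (hQ u v))

end Moments

/-! ### The error dynamics of the distributed algorithm -/

section Update

variable {nb nr : ℕ} (G : SimpleGraph (Node nb nr)) (w : Node nb nr → Node nb nr → ℝ)

open Classical in
/-- The total weight that the node `u` uses in one update. -/
noncomputable def totalWeight (u : Node nb nr) : ℝ := w u u + ∑ v ∈ G.neighborFinset u, w v u

open Classical in
/-- The relative weight that the node `u` gives to the information received from `v`. -/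
noncomputable def relWeight (u v : Node nb nr) : ℝ :=
  (if v = u then w u u else if G.Adj u v then w v u else 0) / totalWeight G w u

/-- The matrix of one step of the error dynamics. The errors of reference nodes are zero, so that
only the other nodes occur. -/
noncomputable def errorMatrix : Matrix (Fin nb) (Fin nb) ℝ :=
  fun u v => relWeight G w (.inl u) (.inl v)

open Classical in
/-- The matrix through which the noise enters the error dynamics: only the noise of the
measurements made by `u` itself enters the error of `u`. -/
noncomputable def noiseMatrix : Matrix (Fin nb) (Node nb nr × Node nb nr) ℝ :=
  fun u c => if c.1 = .inl u ∧ G.Adj c.1 c.2 then relWeight G w c.1 c.2 else 0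

variable {G w}

theorem totalWeight_pos (hw : ∀ u, 0 < w u u) (hw' : ∀ u v, G.Adj u v → 0 < w v u)
    (u : Node nb nr) : 0 < totalWeight G w u := by
  classical
  exact add_pos_of_pos_of_nonneg (hw u) (Finset.sum_nonneg fun v hv =>
    (hw' u v (by simpa using hv)).le)

theorem relWeight_nonneg (hw : ∀ u, 0 < w u u) (hw' : ∀ u v, G.Adj u v → 0 < w v u)
    (u v : Node nb nr) : 0 ≤ relWeight G w u v := by
  refine div_nonneg ?_ (totalWeight_pos hw hw' u).le
  split_ifs with h h'
  exacts [(hw u).le, (hw' u v h').le, le_rfl]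

theorem relWeight_self_pos (hw : ∀ u, 0 < w u u) (hw' : ∀ u v, G.Adj u v → 0 < w v u)
    (u : Node nb nr) : 0 < relWeight G w u u := by
  rw [relWeight, if_pos rfl]
  exact div_pos (hw u) (totalWeight_pos hw hw' u)

theorem relWeight_pos (hw : ∀ u, 0 < w u u) (hw' : ∀ u v, G.Adj u v → 0 < w v u)
    {u v : Node nb nr} (h : G.Adj u v) : 0 < relWeight G w u v := by
  rw [relWeight, if_neg h.ne', if_pos h]
  exact div_pos (hw' u v h) (totalWeight_pos hw hw' u)

open Classical in
/-- The relative weights average a function over a node and its neighbors. -/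
theorem sum_relWeight_mul (u : Node nb nr) (y : Node nb nr → ℝ) :
    ∑ v, relWeight G w u v * y v =
      (w u u * y u + ∑ v ∈ G.neighborFinset u, w v u * y v) / totalWeight G w u := by
  have h : ∀ v, relWeight G w u v * y v = ((if v = u then w u u * y u else 0) +
      if G.Adj u v then w v u * y v else 0) / totalWeight G w u := by
    intro v
    rw [relWeight, div_mul_eq_mul_div]
    congr 1
    rcases eq_or_ne v u with rfl | hne
    · simp
    · simp [hne]
  rw [Finset.sum_congr rfl fun v _ => h v, ← Finset.sum_div, Finset.sum_add_distrib,
    Finset.sum_ite_eq' Finset.univ u, if_pos (Finset.mem_univ u),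
    SimpleGraph.neighborFinset_eq_filter, Finset.sum_filter]

theorem sum_relWeight (hw : ∀ u, 0 < w u u) (hw' : ∀ u v, G.Adj u v → 0 < w v u)
    (u : Node nb nr) : ∑ v, relWeight G w u v = 1 := by
  have h := sum_relWeight_mul (G := G) (w := w) u fun _ => 1
  simp only [mul_one] at h
  rw [h]
  exact div_self (totalWeight_pos hw hw' u).ne'

theorem relWeight_le_one (hw : ∀ u, 0 < w u u) (hw' : ∀ u v, G.Adj u v → 0 < w v u)
    (u v : Node nb nr) : relWeight G w u v ≤ 1 := by
  rw [← sum_relWeight hw hw' u]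
  exact Finset.single_le_sum (fun v _ => relWeight_nonneg hw hw' u v) (Finset.mem_univ v)

theorem sum_errorMatrix_add (hw : ∀ u, 0 < w u u) (hw' : ∀ u v, G.Adj u v → 0 < w v u)
    (u : Fin nb) :
    ∑ v, errorMatrix G w u v + ∑ r, relWeight G w (.inl u) (.inr r) = 1 := by
  rw [← sum_relWeight hw hw' (.inl u), Fintype.sum_sum_type]
  rfl

theorem sum_errorMatrix_le_one (hw : ∀ u, 0 < w u u) (hw' : ∀ u v, G.Adj u v → 0 < w v u)
    (u : Fin nb) : ∑ v, errorMatrix G w u v ≤ 1 := by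
  rw [← sum_errorMatrix_add hw hw' u]
  exact le_add_of_nonneg_right (Finset.sum_nonneg fun r _ => relWeight_nonneg hw hw' _ _)

theorem sum_errorMatrix_lt_one (hw : ∀ u, 0 < w u u) (hw' : ∀ u v, G.Adj u v → 0 < w v u)
    {u : Fin nb} {r : Fin nr} (h : G.Adj (.inl u) (.inr r)) : ∑ v, errorMatrix G w u v < 1 := by
  rw [← sum_errorMatrix_add hw hw' u]
  exact lt_add_of_pos_right _ (Finset.sum_pos' (fun r _ => relWeight_nonneg hw hw' _ _)
    ⟨r, Finset.mem_univ r, relWeight_pos hw hw' h⟩)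

theorem noiseMatrix_mem (hw : ∀ u, 0 < w u u) (hw' : ∀ u v, G.Adj u v → 0 < w v u)
    (u : Fin nb) (c : Node nb nr × Node nb nr) : noiseMatrix G w u c ∈ Set.Icc 0 1 := by
  rw [noiseMatrix]
  split_ifs
  · exact ⟨relWeight_nonneg hw hw' _ _, relWeight_le_one hw hw' _ _⟩
  · simp

open Classical in
theorem sum_noiseMatrix_mul (u : Fin nb) (ε : Node nb nr × Node nb nr → ℝ) :
    ∑ c, noiseMatrix G w u c * ε c =
      (∑ v ∈ G.neighborFinset (.inl u), w v (.inl u) * ε (.inl u, v)) /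
        totalWeight G w (.inl u) := by
  rw [Fintype.sum_prod_type, Finset.sum_eq_single (.inl u), Finset.sum_div,
    SimpleGraph.neighborFinset_eq_filter, Finset.sum_filter]
  · refine Finset.sum_congr rfl fun v _ => ?_
    by_cases h : G.Adj (.inl u) v
    · simp [noiseMatrix, relWeight, h, h.ne', div_mul_eq_mul_div]
    · simp [noiseMatrix, h]
  · intro a _ ha
    exact Finset.sum_eq_zero fun b _ => by simp [noiseMatrix, ha]
  · simp

/-- One update, in terms of the errors: the true node variables cancel. -/
theorem update_sub (hw : ∀ u, 0 < w u u) (hw' : ∀ u v, G.Adj u v → 0 < w v u)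
    (ε : Node nb nr × Node nb nr → ℝ) {x xhat : Node nb nr → ℝ}
    (href : ∀ r, xhat (.inr r) = x (.inr r)) (u : Fin nb) :
    update G w (fun u v => x u - x v + ε (u, v)) x xhat (.inl u) - x (.inl u) =
      ∑ v, errorMatrix G w u v * (xhat (.inl v) - x (.inl v)) +
        ∑ c, noiseMatrix G w u c * ε c := by
  classical
  have h1 : ∑ v, errorMatrix G w u v * (xhat (.inl v) - x (.inl v)) =
      ∑ v, relWeight G w (.inl u) v * (xhat v - x v) := by
    rw [Fintype.sum_sum_type]
    simp [href, errorMatrix]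
  rw [h1, sum_relWeight_mul, sum_noiseMatrix_mul, ← add_div,
    eq_div_iff (totalWeight_pos hw hw' _).ne', sub_mul, update]
  change _ / totalWeight G w (.inl u) * _ - _ = _
  rw [div_mul_cancel₀ _ (totalWeight_pos hw hw' _).ne', totalWeight, mul_add, Finset.mul_sum,
    add_assoc, ← Finset.sum_add_distrib, add_sub_add_comm, ← Finset.sum_sub_distrib]
  congr 1
  · ring
  · exact Finset.sum_congr rfl fun v _ => by ring

end Update

section Algorithm

variable {N nb nr : ℕ} {G : Fin N → SimpleGraph (Node nb nr)}
  {w : ℕ → Fin N → Node nb nr → Node nb nr → ℝ}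

theorem estimate_inr (x : Node nb nr → ℝ) (x0 : Fin nb → ℝ) (s : ℕ → Fin N)
    (ε : ℕ → Node nb nr × Node nb nr → ℝ) (k : ℕ) (r : Fin nr) :
    estimate G w x x0 s ε k (.inr r) = x (.inr r) := by
  cases k <;> rfl

theorem unionGraph_adj {a b : Node nb nr} : (unionGraph G).Adj a b ↔ ∃ i, (G i).Adj a b := by
  simp [unionGraph]

theorem isLeaky_errorMatrix {w : Fin N → Node nb nr → Node nb nr → ℝ}
    (hw : ∀ i u, 0 < w i u u) (hw' : ∀ i u v, (G i).Adj u v → 0 < w i v u)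
    (h : ∀ u : Fin nb, ∃ r : Fin nr, (unionGraph G).Reachable (.inl u) (.inr r)) :
    IsLeaky fun i => errorMatrix (G i) (w i) where
  nonneg i u v := relWeight_nonneg (hw i) (hw' i) _ _
  sum_le_one i u := sum_errorMatrix_le_one (hw i) (hw' i) u
  diag_pos i u := relWeight_self_pos (hw i) (hw' i) _
  mem_of_closed T hleak hpred u := by
    -- walk back from a reference node, which counts as a member of `T`
    set C : Node nb nr → Prop := Sum.elim (· ∈ T) fun _ => True
    have hstep : ∀ a b, (unionGraph G).Adj a b → C b → C a := by
      intro a b hab hb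
      obtain ⟨i, hi⟩ := unionGraph_adj.1 hab
      match a, b with
      | .inr _, _ => trivial
      | .inl a, .inr r => exact hleak i a (sum_errorMatrix_lt_one (hw i) (hw' i) hi)
      | .inl a, .inl b => exact hpred i a b (relWeight_pos (hw i) (hw' i) hi) hb
    have hwalk : ∀ a b, (unionGraph G).Walk a b → C b → C a := by
      intro a b p
      induction p with
      | nil => exact id
      | cons hab _ ih => exact fun hc => hstep _ _ hab (ih hc)
    obtain ⟨r, ⟨p⟩⟩ := h u
    exact hwalk _ _ p trivial

/-- If no reference node can be reached from the set `C`, then shifting the initial estimates on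
`C` by one shifts all later estimates on `C` by one. -/
theorem estimate_add_one (hw : ∀ k i u, 0 < w k i u u)
    (hw' : ∀ k i u v, (G i).Adj u v → 0 < w k i v u) {C : Set (Node nb nr)}
    (hC : ∀ i a b, a ∈ C → (G i).Adj a b → b ∈ C) (href : ∀ r, .inr r ∉ C)
    (x : Node nb nr → ℝ) {x0 x0' : Fin nb → ℝ} (hx : ∀ u, .inl u ∈ C → x0' u = x0 u + 1)
    (s : ℕ → Fin N) (ε : ℕ → Node nb nr × Node nb nr → ℝ) (k : ℕ) :
    ∀ a ∈ C, estimate G w x x0' s ε k a = estimate G w x x0 s ε k a + 1 := by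
  classical
  induction k with
  | zero =>
    rintro (u | r) ha
    · exact hx u ha
    · exact (href r ha).elim
  | succ k ih =>
    rintro (u | r) ha
    · have hpos := totalWeight_pos (hw k (s k)) (hw' k (s k)) (.inl u)
      simp only [estimate, update]
      change _ / totalWeight (G (s k)) (w k (s k)) (.inl u) =
        _ / totalWeight (G (s k)) (w k (s k)) (.inl u) + 1
      rw [div_add_one hpos.ne', ih _ ha, totalWeight, add_add_add_comm,
        ← Finset.sum_add_distrib]
      congr 2
      · ring
      · refine Finset.sum_congr rfl fun v hv => ?_
        rw [ih v (hC _ _ _ ha (by simpa using hv))]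
        ring
    · exact (href r ha).elim

variable {Ω : Type*} [MeasurableSpace Ω] {μ : Measure Ω} [IsProbabilityMeasure μ]
  {x : Node nb nr → ℝ} {P : Matrix (Fin N) (Fin N) ℝ} {θ : ℕ → Ω → Fin N}
  {ε : ℕ → Node nb nr × Node nb nr → Ω → ℝ}

theorem isMeanSquareConvergent_of_reachable (hw : ∀ k i u, 0 < w k i u u)
    (hw' : ∀ k i u v, (G i).Adj u v → 0 < w k i v u) {k₀ : ℕ} (hconst : ∀ k, k₀ ≤ k → w k = w k₀)
    (hP : IsErgodic P) (hd : ∀ i, 0 < P i i) (hθ : IsMarkovChain P θ μ)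
    (hε : IsWideSenseStationary ε μ)
    (hind : IndepFun (fun ω k a => ε k a ω) (fun ω k => θ k ω) μ)
    (h : ∀ u : Fin nb, ∃ r : Fin nr, (unionGraph G).Reachable (.inl u) (.inr r)) :
    IsMeanSquareConvergent G w x θ ε μ := by
  obtain ⟨m, Q, hlim⟩ := hθ.exists_hasMeanSquareLimit hP hd
    (A := fun k i => errorMatrix (G i) (w k i)) (B := fun k i => noiseMatrix (G i) (w k i))
    (fun k i u v => relWeight_nonneg (hw k i) (hw' k i) _ _)
    (fun k i u => sum_errorMatrix_le_one (hw k i) (hw' k i) u)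
    (fun k i u c => noiseMatrix_mem (hw k i) (hw' k i) u c)
    (fun k hk => by simp only [hconst k hk]) (fun k hk => by simp only [hconst k hk])
    (isLeaky_errorMatrix (hw k₀) (hw' k₀) h) hε hind
  refine ⟨m, Q, fun x0 hx0 => hlim _ (fun u => (hx0.memLp u).sub (memLp_const _)) ?_ ?_⟩
  · exact hx0.indep.comp
      (φ := fun y : (Fin nb → ℝ) × (ℕ → Node nb nr × Node nb nr → ℝ) => fun u =>
        y.1 u - x (.inl u)) (by fun_prop) measurable_id
  · intro k u ω
    exact update_sub (hw k _) (hw' k _) (fun a => ε k a ω)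
      (fun r => estimate_inr x _ _ _ k r) u

theorem isInitialCondition_const (hind : IndepFun (fun ω k a => ε k a ω) (fun ω k => θ k ω) μ)
    (c : Fin nb → ℝ) : IsInitialCondition (fun u _ => c u) θ ε μ where
  measurable u := measurable_const
  memLp u := memLp_const _
  indep := hind.comp (φ := fun y : ℕ → Node nb nr × Node nb nr → ℝ => (c, y))
    (by fun_prop) measurable_id

/-- If no reference node can be reached from `u`, then two constant initial conditions that differ
by one on the component of `u` lead to mean errors of `u` that differ by one at all times. -/
theorem reachable_of_isMeanSquareConvergent (hw : ∀ k i u, 0 < w k i u u)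
    (hw' : ∀ k i u v, (G i).Adj u v → 0 < w k i v u)
    (hind : IndepFun (fun ω k a => ε k a ω) (fun ω k => θ k ω) μ)
    (h : IsMeanSquareConvergent G w x θ ε μ) (u : Fin nb) :
    ∃ r : Fin nr, (unionGraph G).Reachable (.inl u) (.inr r) := by
  classical
  by_contra! hu
  obtain ⟨m, Q, hlim⟩ := h
  have h0 := hlim _ (isInitialCondition_const hind 0)
  have h1 := hlim _ (isInitialCondition_const hind
    fun v => if (unionGraph G).Reachable (.inl u) (.inl v) then 1 else 0)
  have hshift := fun k ω => estimate_add_one hw hw'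
    (C := {a | (unionGraph G).Reachable (.inl u) a})
    (fun i a b ha hab =>
      ha.trans (unionGraph_adj.2 ⟨i, hab⟩ : (unionGraph G).Adj a b).reachable) hu x
    (x0 := 0) (x0' := fun v => if (unionGraph G).Reachable (.inl u) (.inl v) then 1 else 0)
    (fun v hv => by simpa using hv) (fun j => θ j ω) (fun j a => ε j a ω) k (.inl u)
    (SimpleGraph.Reachable.refl _)
  have hmean : ∀ k, ∫ ω, estimationError G w x
      (fun v _ => if (unionGraph G).Reachable (.inl u) (.inl v) then 1 else 0) θ ε k u ω ∂μ =
      ∫ ω, estimationError G w x (fun v _ => (0 : Fin nb → ℝ) v) θ ε k u ω ∂μ + 1 := by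
    intro k
    have hone : ∫ _, (1 : ℝ) ∂μ = 1 := by simp
    conv_rhs => rw [← hone]
    rw [← integral_add ((h0.memLp k u).integrable one_le_two) (integrable_const _)]
    congr 1 with ω
    rw [estimationError, estimationError, hshift k ω, add_sub_right_comm]
  have hm := h1.mean u
  simp only [hmean] at hm
  have := tendsto_nhds_unique hm ((h0.mean u).add_const 1)
  linarith

end Algorithm

end RelMeas

theorem theorem1
    {Ω : Type*} [MeasurableSpace Ω] (μ : Measure Ω) [IsProbabilityMeasure μ]
    {N nb nr : ℕ} (hnr : 1 ≤ nr)
    (G : Fin N → SimpleGraph (RelMeas.Node nb nr))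
    (w : ℕ → Fin N → RelMeas.Node nb nr → RelMeas.Node nb nr → ℝ)
    (hw_self : ∀ k i u, 0 < w k i u u)
    (hw_adj : ∀ k i u v, (G i).Adj u v → 0 < w k i v u)
    (hw_const : ∃ k₀, ∀ k, k₀ ≤ k → w k = w k₀)
    (x : RelMeas.Node nb nr → ℝ)
    (P : Matrix (Fin N) (Fin N) ℝ) (hP : RelMeas.IsErgodic P) (hP_diag : ∀ i, 0 < P i i)
    (θ : ℕ → Ω → Fin N) (hθ : RelMeas.IsMarkovChain P θ μ)
    (ε : ℕ → RelMeas.Node nb nr × RelMeas.Node nb nr → Ω → ℝ)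
    (hε : RelMeas.IsWideSenseStationary ε μ)
    (hε_symm : ∀ k u v ω, ε k (v, u) ω = -ε k (u, v) ω)
    (hε_indep : IndepFun (fun ω k a => ε k a ω) (fun ω k => θ k ω) μ) :
    -- a single reference node
    (nr = 1 →
      (RelMeas.IsMeanSquareConvergent G w x θ ε μ ↔ (RelMeas.unionGraph G).Connected)) ∧
    -- any number of reference nodes
    ((RelMeas.unionGraph G).Connected → RelMeas.IsMeanSquareConvergent G w x θ ε μ) ∧
    (RelMeas.IsMeanSquareConvergent G w x θ ε μ ↔
      ∀ u : Fin nb, ∃ r : Fin nr, (RelMeas.unionGraph G).Reachable (.inl u) (.inr r)) := by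
  obtain ⟨k₀, hk₀⟩ := hw_const
  have hiff : RelMeas.IsMeanSquareConvergent G w x θ ε μ ↔
      ∀ u : Fin nb, ∃ r : Fin nr, (RelMeas.unionGraph G).Reachable (.inl u) (.inr r) :=
    ⟨RelMeas.reachable_of_isMeanSquareConvergent hw_self hw_adj hε_indep,
      RelMeas.isMeanSquareConvergent_of_reachable hw_self hw_adj hk₀ hP hP_diag hθ hε hε_indep⟩
  refine ⟨?_, fun h => hiff.2 fun u => ⟨⟨0, hnr⟩, h.preconnected _ _⟩, hiff⟩
  rintro rfl
  rw [hiff]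
  refine ⟨fun h => ?_, fun h u => ⟨0, h.preconnected _ _⟩⟩
  rw [SimpleGraph.connected_iff_exists_forall_reachable]
  refine ⟨.inr 0, ?_⟩
  rintro (u | r)
  · obtain ⟨r, hr⟩ := h u
    rw [Subsingleton.elim r 0] at hr
    exact hr.symm
  · rw [Subsingleton.elim r 0]
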